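/- Let $0<D<\infty$ and $\gamma\in\mathbb{R}$, and consider on $\mathbb{R}^2$ the perturbed closed-loop system \[ \dot x_1(t)=x_2(t),\qquad \dot x_2(t)=-\gamma\,\mathrm{sign}(x_1(t))-\delta(x(t))+d(t),\qquad t\ge 0, \] \[ \delta(x)=\begin{cases}|x_2|\,|x_1|^{-1}x_2 & \text{if } x_1x_2<0,\\ 0&\text{otherwise,}\end{cases} \] where the disturbance $d$ is Lebesgue measurable with $\operatorname{ess\,sup}_{t\ge0}|d(t)|\le D$. Solutions are understood in the sense of Filippov: they are locally absolutely continuous functions $x$ with $\dot x(t)\in\bigcap_{r>0}\bigcap_{|N|=0}\overline{\mathrm{co}}\,f(t,B(x(t),r)\setminus N)$ for almost every $t$, where $f$ is the right-hand side of the system. If \[ \gamma>2\sqrt2\,D^{3/2}+D+\tfrac12, \] then the origin is uniformly globally asymptotically stable, uniformly over all such disturbances $d$. That is: (i) for every such $d$, every $x_0\in\mathbb{R}^2$ is the initial value of a solution on $[0,\infty)$, and every solution on an interval $[0,T)$, $0<T<\infty$, extends to a solution on $[0,\infty)$; (ii) there is a function $\alpha:[0,\infty)\to[0,\infty)$ of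 class $\mathcal K_\infty$ (continuous, strictly increasing, unbounded, $\alpha(0)=0$) such that, for every $\varepsilon\ge0$ and every such $d$, every solution on $[0,\infty)$ with $|x(0)|\le\alpha(\varepsilon)$ satisfies $|x(t)|\le\varepsilon$ for all $t\ge0$; (iii) for all $r,\varepsilon>0$ there is $T>0$ such that, for every such $d$, every solution on $[0,\infty)$ with $|x(0)|<r$ satisfies $|x(t)|<\varepsilon$ for all $t\ge T$. -/

import Mathlib

open MeasureTheory Set Filter

/-- Filippov regularization of a vector field `g` at the point `x`:
the intersection, over all radii `r > 0` and all Lebesgue-null sets `N`, of the closed convex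
hulls of `g (B(x, r) \ N)`. -/
def filippovSet {E : Type*} [NormedAddCommGroup E] [NormedSpace ℝ E] [MeasureSpace E]
    (g : E → E) (x : E) : Set E :=
  ⋂ (r : ℝ) (_ : 0 < r) (N : Set E) (_ : (volume : Measure E) N = 0),
    closedConvexHull ℝ (g '' (Metric.ball x r \ N))

/-- `x` is a Filippov solution of `x' = f(t, x)` on the time interval `J`: it is absolutely
continuous on every compact interval contained in `J`, and for almost every `t ∈ J` it is
differentiable at `t` with derivative in the Filippov regularization of `f(t, ·)` at `x(t)`. -/
def IsFilippovSolutionOn {E : Type*} [NormedAddCommGroup E] [NormedSpace ℝ E] [MeasureSpace E]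
    (f : ℝ → E → E) (x : ℝ → E) (J : Set ℝ) : Prop :=
  (∀ a b : ℝ, a ≤ b → Icc a b ⊆ J → AbsolutelyContinuousOnInterval x a b) ∧
  ∀ᵐ t ∂(volume.restrict J), ∃ v ∈ filippovSet (f t) (x t), HasDerivAt x v t

/-- Functions of class `K∞` on `[0, ∞)`. -/
structure IsClassKInfty (α : ℝ → ℝ) : Prop where
  continuousOn : ContinuousOn α (Ici 0)
  strictMonoOn : StrictMonoOn α (Ici 0)
  map_zero : α 0 = 0
  tendsto_atTop : Tendsto α atTop atTop

/-- The origin is uniformly globally asymptotically stable for the family of systems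
`x' = f(t, x)`, `f ∈ 𝓕`, with solutions understood in the sense of Filippov, and uniformity
understood with respect to `f ∈ 𝓕`. -/
structure IsUniformlyGloballyAsymptoticallyStable
    {E : Type*} [NormedAddCommGroup E] [NormedSpace ℝ E] [MeasureSpace E]
    (𝓕 : Set (ℝ → E → E)) : Prop where
  /-- Every initial state is the initial state of a solution on `[0, ∞)`. -/
  exists_solution : ∀ f ∈ 𝓕, ∀ x₀ : E,
    ∃ x : ℝ → E, IsFilippovSolutionOn f x (Ici 0) ∧ x 0 = x₀
  /-- Forward completeness: every local solution extends to a solution on `[0, ∞)`. -/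
  forward_complete : ∀ f ∈ 𝓕, ∀ T : ℝ, 0 < T → ∀ x : ℝ → E, IsFilippovSolutionOn f x (Ico 0 T) →
    ∃ y : ℝ → E, IsFilippovSolutionOn f y (Ici 0) ∧ EqOn x y (Ico 0 T)
  /-- Uniform global stability. -/
  uniform_stability : ∃ δ : ℝ → ℝ, IsClassKInfty δ ∧
    ∀ ε : ℝ, 0 ≤ ε → ∀ f ∈ 𝓕, ∀ x : ℝ → E, IsFilippovSolutionOn f x (Ici 0) →
      ‖x 0‖ ≤ δ ε → ∀ t : ℝ, 0 ≤ t → ‖x t‖ ≤ ε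
  /-- Uniform global attraction. -/
  uniform_attraction : ∀ r : ℝ, 0 < r → ∀ ε : ℝ, 0 < ε → ∃ T : ℝ, 0 < T ∧
    ∀ f ∈ 𝓕, ∀ x : ℝ → E, IsFilippovSolutionOn f x (Ici 0) →
      ‖x 0‖ < r → ∀ t : ℝ, T ≤ t → ‖x t‖ < ε

/-- Disturbances: Lebesgue measurable on `[0, ∞)` with `ess sup_{t ≥ 0} |d(t)| ≤ D`. -/
def IsAdmissibleDisturbance (D : ℝ) (d : ℝ → ℝ) : Prop :=
  AEMeasurable d (volume.restrict (Ici 0)) ∧ ∀ᵐ t ∂(volume.restrict (Ici (0 : ℝ))), |d t| ≤ D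

/-- The nonlinear damping term. -/
noncomputable def damping (x : EuclideanSpace ℝ (Fin 2)) : ℝ :=
  if x 0 * x 1 < 0 then |x 1| * |x 0|⁻¹ * x 1 else 0

/-- The feedback law. -/
noncomputable def feedbackLaw (γ : ℝ) (x : EuclideanSpace ℝ (Fin 2)) : ℝ :=
  -γ * Real.sign (x 0) - damping x

/-- The right-hand side of the closed loop `x₁' = x₂`, `x₂' = u + d(t)`. -/
noncomputable def closedLoop (γ : ℝ) (d : ℝ → ℝ) (t : ℝ) (x : EuclideanSpace ℝ (Fin 2)) :
    EuclideanSpace ℝ (Fin 2) :=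
  !₂[x 1, feedbackLaw γ x + d t]

/-!
Write `X = x 0`, `Y = x 1`, `m = γ - D` and `M = γ + D`; the gain condition gives `0 < m`.
Away from the line `X = 0` the field is continuous, so a Filippov solution satisfies the equation
there, and by the symmetry `x ↦ -x` it suffices to look at `X > 0`, where `X' = Y` and
`Y' = -g + min(Y, 0)² / X` with `m ≤ g ≤ M`.

* The energy `m X + max(Y, 0)² / 2` does not increase (`IsRightArc.energy_le`), and every parabola
  `Y² = C X` with `C ≥ 2M` is a barrier (`IsRightArc.sq_sub_le`). The damping is therefore bounded
  along an arc, and an arc can reach the line `X = 0` only at the origin. As the energy vanishes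
  there, the origin is absorbing (`IsInclusionArc.eq_zero_of_eq_zero`), so that an arc never changes
  from one half-plane to the other. The two estimates bound the state by the initial state, which is
  stability.
* A positive velocity is spent after a bounded time. Afterwards, in the fourth quadrant, the damping
  cancels in the derivative of the slope: `(Y / X)' = -g / X`. Hence the slope decreases at least
  linearly and `X` decays like a Gaussian (`IsRightArc.position_mul_exp_le`), while
  `(Y / X)² - 2M / X` does not increase, which controls `Y` (`IsRightArc.sq_velocity_le`). This is
  attraction.
* For existence, the measurable disturbance is removed by subtracting its primitive from `Y`, and the
  Picard–Lindelöf theorem applies as long as `X` is bounded below (`exists_scalar_solution`). Solutions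
  that halve `X` are concatenated; if the halving times accumulate, the solution is Lipschitz up to
  the limit time because of the parabolic barrier, it reaches the origin there, and it is continued
  by the equilibrium. The same Lipschitz bound gives forward completeness.

All differential inequalities hold almost everywhere along absolutely continuous functions and are
integrated by `AbsolutelyContinuousOnInterval.le_of_ae_deriv_nonpos` and its barrier version
`AbsolutelyContinuousOnInterval.le_max_of_ae_deriv_nonpos`.
-/

/-! ### Absolutely continuous functions -/

namespace AbsolutelyContinuousOnInterval

theorem comp_lipschitzOnWith {X Y : Type*} [PseudoMetricSpace X] [PseudoMetricSpace Y]
    {f : ℝ → X} {g : X → Y} {a b : ℝ} {K : NNReal}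
    (hf : AbsolutelyContinuousOnInterval f a b) (hg : LipschitzOnWith K g (f '' uIcc a b)) :
    AbsolutelyContinuousOnInterval (fun t => g (f t)) a b := by
  have h0 := Tendsto.const_mul (K : ℝ) hf
  rw [mul_zero] at h0
  refine squeeze_zero' (Eventually.of_forall fun E => Finset.sum_nonneg fun i _ => dist_nonneg)
    ?_ h0
  filter_upwards [mem_inf_of_right (mem_principal_self _)] with E hE
  rw [Finset.mul_sum]
  refine Finset.sum_le_sum fun i hi => ?_
  exact hg.dist_le_mul _ (mem_image_of_mem _ (hE.1 i hi).1) _ (mem_image_of_mem _ (hE.1 i hi).2)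

theorem congr {X : Type*} [PseudoMetricSpace X] {f g : ℝ → X} {a b : ℝ}
    (hf : AbsolutelyContinuousOnInterval f a b) (h : EqOn f g (uIcc a b)) :
    AbsolutelyContinuousOnInterval g a b := by
  refine hf.congr' ?_
  filter_upwards [mem_inf_of_right (mem_principal_self _)] with E hE
  refine Finset.sum_congr rfl fun i hi => ?_
  rw [h (hE.1 i hi).1, h (hE.1 i hi).2]

/-- Reparametrization by a nonexpansive map that sends intervals into themselves, such as the
truncations `min · c` and `max · c`. -/
theorem comp_of_uIoc_subset {X : Type*} [PseudoMetricSpace X] {f : ℝ → X} {π : ℝ → ℝ}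
    {a b c d : ℝ} (hf : AbsolutelyContinuousOnInterval f a b)
    (hmap : MapsTo π (uIcc c d) (uIcc a b)) (hdist : ∀ s t, dist (π s) (π t) ≤ dist s t)
    (hsub : ∀ s t, uIoc (π s) (π t) ⊆ uIoc s t) :
    AbsolutelyContinuousOnInterval (fun t => f (π t)) c d := by
  rw [absolutelyContinuousOnInterval_iff] at hf ⊢
  intro ε hε
  obtain ⟨δ, hδ, h⟩ := hf ε hε
  refine ⟨δ, hδ, fun E hE hl => ?_⟩
  refine h (E.1, fun i => (π (E.2 i).1, π (E.2 i).2)) ⟨fun i hi => ?_, fun i hi j hj hij => ?_⟩ ?_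
  · exact ⟨hmap (hE.1 i hi).1, hmap (hE.1 i hi).2⟩
  · exact (hE.2 hi hj hij).mono (hsub _ _) (hsub _ _)
  · exact (Finset.sum_le_sum fun i _ => hdist _ _).trans_lt hl

theorem trans {F : Type*} [SeminormedAddCommGroup F] {f : ℝ → F} {a b c : ℝ}
    (hab : a ≤ b) (hbc : b ≤ c) (h₁ : AbsolutelyContinuousOnInterval f a b)
    (h₂ : AbsolutelyContinuousOnInterval f b c) : AbsolutelyContinuousOnInterval f a c := by
  have hmin : AbsolutelyContinuousOnInterval (fun t => f (min t b)) a c := by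
    refine h₁.comp_of_uIoc_subset (fun t ht => ?_) (fun s t => ?_) (fun s t u hu => ?_)
    · rw [uIcc_of_le (hab.trans hbc)] at ht
      rw [uIcc_of_le hab]
      exact ⟨le_min ht.1 hab, min_le_right _ _⟩
    · simp only [Real.dist_eq]; grind
    · simp only [mem_uIoc] at hu ⊢; grind
  have hmax : AbsolutelyContinuousOnInterval (fun t => f (max t b)) a c := by
    refine h₂.comp_of_uIoc_subset (fun t ht => ?_) (fun s t => ?_) (fun s t u hu => ?_)
    · rw [uIcc_of_le (hab.trans hbc)] at ht
      rw [uIcc_of_le hbc]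
      exact ⟨le_max_right _ _, max_le ht.2 hbc⟩
    · simp only [Real.dist_eq]; grind
    · simp only [mem_uIoc] at hu ⊢; grind
  have hconst : AbsolutelyContinuousOnInterval (fun _ => f b) a c :=
    (LipschitzWith.const (f b)).lipschitzOnWith.absolutelyContinuousOnInterval
  refine ((hmin.fun_add hmax).fun_sub hconst).congr fun t _ => ?_
  rcases le_total t b with h | h <;> simp [h]

/-- A continuously differentiable function is absolutely continuous on compact intervals. -/
theorem of_contDiff {f : ℝ → ℝ} (hf : ContDiff ℝ 1 f) (a b : ℝ) :
    AbsolutelyContinuousOnInterval f a b := by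
  obtain ⟨K, hK⟩ := hf.contDiffOn.exists_lipschitzOnWith one_ne_zero (convex_uIcc a b)
    isCompact_uIcc
  exact hK.absolutelyContinuousOnInterval

/-- Composition with a continuously differentiable function. -/
theorem comp_contDiff {f g : ℝ → ℝ} {a b : ℝ} (hf : AbsolutelyContinuousOnInterval f a b)
    (hg : ContDiff ℝ 1 g) : AbsolutelyContinuousOnInterval (fun t => g (f t)) a b := by
  obtain ⟨C, hC⟩ := hf.exists_bound
  obtain ⟨K, hK⟩ := hg.contDiffOn.exists_lipschitzOnWith one_ne_zero (convex_Icc (-C) C)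
    isCompact_Icc
  refine hf.comp_lipschitzOnWith (hK.mono ?_)
  rintro _ ⟨t, ht, rfl⟩
  exact abs_le.1 (hC t ht)

theorem inv₀ {f : ℝ → ℝ} {a b : ℝ} (hf : AbsolutelyContinuousOnInterval f a b)
    (hpos : ∀ t ∈ uIcc a b, 0 < f t) : AbsolutelyContinuousOnInterval (fun t => (f t)⁻¹) a b := by
  obtain ⟨t₀, ht₀, hmin⟩ := isCompact_uIcc.exists_isMinOn nonempty_uIcc hf.continuousOn
  obtain ⟨C, hC⟩ := hf.exists_bound
  have hd : ContDiffOn ℝ 1 (fun y : ℝ => y⁻¹) (Icc (f t₀) C) :=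
    contDiffOn_id.inv fun y hy => ((hpos t₀ ht₀).trans_le hy.1).ne'
  obtain ⟨K, hK⟩ := hd.exists_lipschitzOnWith one_ne_zero (convex_Icc _ _) isCompact_Icc
  refine hf.comp_lipschitzOnWith (hK.mono ?_)
  rintro _ ⟨t, ht, rfl⟩
  exact ⟨hmin ht, (abs_le.1 (hC t ht)).2⟩

/-- An absolutely continuous function with a.e. nonpositive derivative does not increase. -/
theorem le_of_ae_deriv_nonpos {φ : ℝ → ℝ} {a b : ℝ} (hφ : AbsolutelyContinuousOnInterval φ a b)
    (hab : a ≤ b) (h : ∀ᵐ t, t ∈ Ioo a b → ∃ v ≤ 0, HasDerivAt φ v t) : φ b ≤ φ a := by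
  rw [← sub_nonpos, ← hφ.integral_deriv_eq_sub, intervalIntegral.integral_of_le hab,
    integral_Ioc_eq_integral_Ioo]
  refine integral_nonpos_of_ae ?_
  rw [EventuallyLE, ae_restrict_iff' measurableSet_Ioo]
  filter_upwards [h] with t ht hmem
  obtain ⟨v, hv, hd⟩ := ht hmem
  rw [hd.deriv]
  exact hv

/-- Barrier principle: if an absolutely continuous function has a.e. nonpositive derivative while
it is above the level `c`, then it cannot rise above both its initial value and `c`. -/
theorem le_max_of_ae_deriv_nonpos {φ : ℝ → ℝ} {a b c : ℝ}
    (hφ : AbsolutelyContinuousOnInterval φ a b) (hab : a ≤ b)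
    (h : ∀ᵐ t, t ∈ Ioo a b → c < φ t → ∃ v ≤ 0, HasDerivAt φ v t) : φ b ≤ max (φ a) c := by
  by_contra! hlt
  have hc : ContinuousOn φ (Icc a b) := by simpa [uIcc_of_le hab] using hφ.continuousOn
  set S := {t ∈ Icc a b | φ t ≤ max (φ a) c} with hS
  have hScl : IsClosed S := hc.preimage_isClosed_of_isClosed isClosed_Icc isClosed_Iic
  have hSne : S.Nonempty := ⟨a, ⟨le_rfl, hab⟩, le_max_left _ _⟩
  have hSbd : BddAbove S := ⟨b, fun t ht => ht.1.2⟩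
  have hs : sSup S ∈ S := hScl.csSup_mem hSne hSbd
  set s := sSup S
  have hle : φ b ≤ φ s := by
    refine (hφ.mono ?_).le_of_ae_deriv_nonpos hs.1.2 ?_
    · rw [uIcc_of_le hab, uIcc_of_le hs.1.2]
      exact Icc_subset_Icc_left hs.1.1
    · filter_upwards [h] with t ht hmem
      refine ht ⟨hs.1.1.trans_lt hmem.1, hmem.2⟩ ?_
      by_contra! hle
      exact hmem.1.not_ge
        (le_csSup hSbd ⟨⟨hs.1.1.trans hmem.1.le, hmem.2.le⟩, hle.trans (le_max_right _ _)⟩)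
  exact (hlt.trans_le hle).not_ge hs.2

/-- An absolutely continuous function with a.e. bounded derivative is Lipschitz. -/
theorem abs_sub_le_of_ae_deriv_le {φ : ℝ → ℝ} {a b K : ℝ}
    (hφ : AbsolutelyContinuousOnInterval φ a b) (hab : a ≤ b)
    (h : ∀ᵐ t, t ∈ Ioo a b → ∃ v, |v| ≤ K ∧ HasDerivAt φ v t) : |φ b - φ a| ≤ K * (b - a) := by
  have hlin : AbsolutelyContinuousOnInterval (fun t => K * t) a b :=
    of_contDiff (by fun_prop) a b
  have h₁ := (hφ.fun_sub hlin).le_of_ae_deriv_nonpos hab (by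
    filter_upwards [h] with t ht hmem
    obtain ⟨v, hv, hd⟩ := ht hmem
    refine ⟨v - K, by linarith [(abs_le.1 hv).2], ?_⟩
    simpa using hd.fun_sub ((hasDerivAt_id t).const_mul K))
  have h₂ := (hφ.fun_neg.fun_sub hlin).le_of_ae_deriv_nonpos hab (by
    filter_upwards [h] with t ht hmem
    obtain ⟨v, hv, hd⟩ := ht hmem
    refine ⟨-v - K, by linarith [(abs_le.1 hv).1], ?_⟩
    simpa using hd.fun_neg.fun_sub ((hasDerivAt_id t).const_mul K))
  rw [abs_le]
  constructor <;> nlinarith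

end AbsolutelyContinuousOnInterval

/-! ### Arcs in the right half-plane -/

/-- An arc of the planar differential inclusion `X' = Y`, `Y' ∈ -[m, M] + min(Y, 0)² / X` on
`[a, b]` with values in the right half-plane `X > 0` on the open interval. -/
structure IsRightArc (m M : ℝ) (X Y : ℝ → ℝ) (a b : ℝ) : Prop where
  acX : AbsolutelyContinuousOnInterval X a b
  acY : AbsolutelyContinuousOnInterval Y a b
  pos : ∀ t ∈ Ioo a b, 0 < X t
  deriv : ∀ᵐ t, t ∈ Ioo a b → HasDerivAt X (Y t) t ∧
    ∃ g ∈ Icc m M, HasDerivAt Y (-g + min (Y t) 0 ^ 2 / X t) t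

theorem hasDerivAt_max_zero_sq (y : ℝ) : HasDerivAt (fun y : ℝ => max y 0 ^ 2) (2 * max y 0) y := by
  rcases lt_trichotomy y 0 with hy | rfl | hy
  · rw [max_eq_right hy.le, mul_zero]
    refine (hasDerivAt_const y (0 : ℝ)).congr_of_eventuallyEq ?_
    filter_upwards [eventually_lt_nhds hy] with z hz
    rw [max_eq_right hz.le]; norm_num
  · have : (fun y : ℝ => max y 0 ^ 2) =O[nhds 0] fun y => ‖y - 0‖ ^ 2 := by
      refine Asymptotics.IsBigO.of_bound 1 (Eventually.of_forall fun y => ?_)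
      simp only [sub_zero, Real.norm_eq_abs, abs_pow, one_mul, abs_abs]
      refine pow_le_pow_left₀ (abs_nonneg _) ?_ 2
      rcases le_total y 0 with h | h <;> simp [h]
    have := (this.hasFDerivAt (𝕜 := ℝ) one_lt_two).hasDerivAt
    simpa using this
  · rw [max_eq_left hy.le]
    have := (hasDerivAt_id y).fun_pow 2
    simp only [id] at this
    refine (this.congr_of_eventuallyEq ?_).congr_deriv (by norm_num)
    filter_upwards [eventually_gt_nhds hy] with z hz
    rw [max_eq_left hz.le]

theorem contDiff_max_zero_sq : ContDiff ℝ 1 (fun y : ℝ => max y 0 ^ 2) := by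
  rw [contDiff_one_iff_deriv]
  refine ⟨fun y => (hasDerivAt_max_zero_sq y).differentiableAt, ?_⟩
  rw [funext fun y => (hasDerivAt_max_zero_sq y).deriv]
  fun_prop

namespace IsRightArc

variable {m M : ℝ} {X Y : ℝ → ℝ} {a b : ℝ}

theorem mono (h : IsRightArc m M X Y a b) {c d : ℝ} (hac : a ≤ c) (hcd : c ≤ d) (hdb : d ≤ b) :
    IsRightArc m M X Y c d := by
  have hsub : uIcc c d ⊆ uIcc a b := by
    rw [uIcc_of_le hcd, uIcc_of_le (hac.trans (hcd.trans hdb))]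
    exact Icc_subset_Icc hac hdb
  have hIoo : Ioo c d ⊆ Ioo a b := Ioo_subset_Ioo hac hdb
  refine ⟨h.acX.mono hsub, h.acY.mono hsub, fun t ht => h.pos t (hIoo ht), ?_⟩
  filter_upwards [h.deriv] with t ht hmem
  exact ht (hIoo hmem)

theorem nonneg_right (h : IsRightArc m M X Y a b) (hab : a < b) : 0 ≤ X b := by
  have hc : ContinuousOn X (Icc a b) := by simpa [uIcc_of_le hab.le] using h.acX.continuousOn
  have h₁ : Tendsto X (nhdsWithin b (Ioo a b)) (nhds (X b)) :=
    ((hc b (right_mem_Icc.2 hab.le)).mono Ioo_subset_Icc_self)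
  have : (nhdsWithin b (Ioo a b)).NeBot := by
    rw [← mem_closure_iff_nhdsWithin_neBot, closure_Ioo hab.ne]
    exact right_mem_Icc.2 hab.le
  exact ge_of_tendsto h₁ (eventually_nhdsWithin_of_forall fun t ht => (h.pos t ht).le)

theorem nonneg_left (h : IsRightArc m M X Y a b) (hab : a < b) : 0 ≤ X a := by
  have hc : ContinuousOn X (Icc a b) := by simpa [uIcc_of_le hab.le] using h.acX.continuousOn
  have h₁ : Tendsto X (nhdsWithin a (Ioo a b)) (nhds (X a)) :=
    ((hc a (left_mem_Icc.2 hab.le)).mono Ioo_subset_Icc_self)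
  have : (nhdsWithin a (Ioo a b)).NeBot := by
    rw [← mem_closure_iff_nhdsWithin_neBot, closure_Ioo hab.ne]
    exact left_mem_Icc.2 hab.le
  exact ge_of_tendsto h₁ (eventually_nhdsWithin_of_forall fun t ht => (h.pos t ht).le)

/-- The energy `m X + max(Y, 0)² / 2` does not increase: on `Y > 0` the deceleration is at least
`m`, and on `Y ≤ 0` the position decreases. -/
theorem energy_le (h : IsRightArc m M X Y a b) (hm : 0 < m) (hab : a ≤ b) :
    m * X b + max (Y b) 0 ^ 2 / 2 ≤ m * X a + max (Y a) 0 ^ 2 / 2 := by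
  have hac : AbsolutelyContinuousOnInterval
      (fun t => m * X t + (1 / 2) * max (Y t) 0 ^ 2) a b :=
    (h.acX.const_mul m).fun_add ((h.acY.comp_contDiff contDiff_max_zero_sq).const_mul (1 / 2))
  have := hac.le_of_ae_deriv_nonpos hab (by
    filter_upwards [h.deriv] with t ht hmem
    obtain ⟨hX, g, hg, hY⟩ := ht hmem
    refine ⟨_, ?_, (hX.const_mul m).fun_add
      (((hasDerivAt_max_zero_sq (Y t)).comp t hY).const_mul (1 / 2))⟩
    rcases le_total (Y t) 0 with hy | hy
    · rw [max_eq_right hy]; nlinarith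
    · rw [max_eq_left hy, min_eq_right hy]
      have := hg.1
      simp only [ne_eq, OfNat.ofNat_ne_zero, not_false_eq_true, zero_pow, zero_div, add_zero]
      nlinarith)
  linarith

/-- The parabola `Y² = C X` with `C ≥ 2M` is a barrier. -/
theorem sq_sub_le (h : IsRightArc m M X Y a b) (hm : 0 < m) (hab : a ≤ b) {C : ℝ}
    (hC : 2 * M ≤ C) : Y b ^ 2 - C * X b ≤ max (Y a ^ 2 - C * X a) 0 := by
  have hac : AbsolutelyContinuousOnInterval (fun t => Y t ^ 2 - C * X t) a b :=
    (h.acY.comp_contDiff (g := fun y => y ^ 2) (by fun_prop)).fun_sub (h.acX.const_mul C)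
  refine hac.le_max_of_ae_deriv_nonpos hab ?_
  filter_upwards [h.deriv] with t ht hmem hpos
  obtain ⟨hX, g, hg, hY⟩ := ht hmem
  refine ⟨_, ?_, (hY.fun_pow 2).fun_sub (hX.const_mul C)⟩
  have hx := h.pos t hmem
  have hg1 := hg.1
  have hg2 := hg.2
  norm_num
  rcases le_total 0 (Y t) with hy | hy
  · rw [min_eq_right hy]
    norm_num
    nlinarith
  · rw [min_eq_left hy]
    have : C < Y t ^ 2 / X t := by rw [lt_div_iff₀ hx]; linarith
    nlinarith

theorem velocity_le_max (h : IsRightArc m M X Y a b) (hm : 0 < m) (hab : a ≤ b) :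
    Y b ≤ max (Y a) 0 := by
  refine h.acY.le_max_of_ae_deriv_nonpos hab ?_
  filter_upwards [h.deriv] with t ht hmem hpos
  obtain ⟨-, g, hg, hY⟩ := ht hmem
  refine ⟨_, ?_, hY⟩
  rw [min_eq_right hpos.le]
  have := hg.1
  norm_num
  linarith

/-- A positive velocity is lost after a time proportional to its initial value. -/
theorem velocity_nonpos (h : IsRightArc m M X Y a b) (hm : 0 < m) (hab : a ≤ b)
    (hlong : Y a ≤ m * (b - a)) : Y b ≤ 0 := by
  by_contra! hb
  have hpos : ∀ t ∈ Icc a b, 0 < Y t := by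
    intro t ht
    by_contra! hle
    have := (h.mono ht.1 ht.2 le_rfl).velocity_le_max hm ht.2
    rw [max_eq_right hle] at this
    linarith
  have hac : AbsolutelyContinuousOnInterval (fun t => Y t + m * t) a b :=
    h.acY.fun_add (.of_contDiff (by fun_prop) a b)
  have := hac.le_of_ae_deriv_nonpos hab (by
    filter_upwards [h.deriv] with t ht hmem
    obtain ⟨-, g, hg, hY⟩ := ht hmem
    refine ⟨_, ?_, hY.fun_add ((hasDerivAt_id t).const_mul m)⟩
    rw [min_eq_right (hpos t (Ioo_subset_Icc_self hmem)).le]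
    have := hg.1
    norm_num
    linarith)
  linarith

theorem velocity_nonpos_of_nonpos (h : IsRightArc m M X Y a b) (hm : 0 < m) (ha : Y a ≤ 0) :
    ∀ t ∈ Icc a b, Y t ≤ 0 := fun t ht => by
  simpa [ha] using (h.mono le_rfl ht.1 ht.2).velocity_le_max hm ht.1

theorem position_le (h : IsRightArc m M X Y a b) (hm : 0 < m) (ha : Y a ≤ 0) :
    ∀ t ∈ Icc a b, X t ≤ X a := fun t ht => by
  have := (h.mono le_rfl ht.1 ht.2).energy_le hm ht.1
  rw [max_eq_right ha] at this
  nlinarith [sq_nonneg (max (Y t) 0)]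

theorem pos_Icc (h : IsRightArc m M X Y a b) (ha : 0 < X a) (hb : 0 < X b) :
    ∀ t ∈ Icc a b, 0 < X t := fun t ht => by
  rcases eq_or_lt_of_le ht.1 with rfl | h₁
  · exact ha
  rcases eq_or_lt_of_le ht.2 with rfl | h₂
  · exact hb
  exact h.pos t ⟨h₁, h₂⟩

theorem ac_slope (h : IsRightArc m M X Y a b) (hab : a ≤ b) (ha : 0 < X a) (hb : 0 < X b) :
    AbsolutelyContinuousOnInterval (fun t => Y t * (X t)⁻¹) a b := by
  refine h.acY.fun_mul (h.acX.inv₀ fun t ht => ?_)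
  rw [uIcc_of_le hab] at ht
  exact h.pos_Icc ha hb t ht

theorem hasDerivAt_slope {X Y : ℝ → ℝ} {t g : ℝ} (hX : HasDerivAt X (Y t) t)
    (hY : HasDerivAt Y (-g + min (Y t) 0 ^ 2 / X t) t) (hx : 0 < X t) (hy : Y t ≤ 0) :
    HasDerivAt (fun t => Y t * (X t)⁻¹) (-g / X t) t := by
  refine (hY.fun_mul (hX.fun_inv hx.ne')).congr_deriv ?_
  rw [min_eq_left hy]
  field_simp
  ring

/-- In the fourth quadrant the damping cancels in the derivative of the slope `Y / X`, which is
therefore at most `-m / X`. -/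
theorem slope_le (h : IsRightArc m M X Y a b) (hm : 0 < m) (hab : a ≤ b) (ha : 0 < X a)
    (hb : 0 < X b) (hya : Y a ≤ 0) {B : ℝ} (hB : X a ≤ B) :
    Y b ≤ -(m / B * (b - a)) * X b := by
  have hac : AbsolutelyContinuousOnInterval (fun t => Y t * (X t)⁻¹ + m / B * t) a b :=
    (h.ac_slope hab ha hb).fun_add (.of_contDiff (by fun_prop) a b)
  have := hac.le_of_ae_deriv_nonpos hab (by
    filter_upwards [h.deriv] with t ht hmem
    obtain ⟨hX, g, hg, hY⟩ := ht hmem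
    have hmem' := Ioo_subset_Icc_self hmem
    have hx := h.pos t hmem
    refine ⟨_, ?_, (hasDerivAt_slope hX hY hx (h.velocity_nonpos_of_nonpos hm hya t hmem')).fun_add
      ((hasDerivAt_id t).const_mul (m / B))⟩
    have h₁ : m / B ≤ g / X t :=
      div_le_div₀ (hm.le.trans hg.1) hg.1 hx ((h.position_le hm hya t hmem').trans hB)
    rw [mul_one, neg_div]
    linarith)
  have hsa : Y a * (X a)⁻¹ ≤ 0 := mul_nonpos_of_nonpos_of_nonneg hya (inv_nonneg.2 ha.le)
  have : Y b * (X b)⁻¹ ≤ -(m / B * (b - a)) := by linarith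
  rwa [← div_eq_mul_inv, div_le_iff₀ hb] at this

theorem position_mul_exp_le (h : IsRightArc m M X Y a b) (hm : 0 < m) (hab : a ≤ b) (ha : 0 < X a)
    (hya : Y a ≤ 0) {B : ℝ} (hB : X a ≤ B) :
    X b * Real.exp (m / (2 * B) * (b - a) ^ 2) ≤ X a := by
  have hac : AbsolutelyContinuousOnInterval
      (fun t => X t * Real.exp (m / (2 * B) * (t - a) ^ 2)) a b :=
    h.acX.fun_mul (.of_contDiff (by fun_prop) a b)
  have := hac.le_of_ae_deriv_nonpos hab (by
    filter_upwards [h.deriv] with t ht hmem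
    obtain ⟨hX, -⟩ := ht hmem
    have hmem' := Ioo_subset_Icc_self hmem
    refine ⟨_, ?_, hX.fun_mul
      (((((hasDerivAt_id t).sub_const a).fun_pow 2).const_mul (m / (2 * B))).exp)⟩
    have := (h.mono le_rfl hmem.1.le hmem.2.le).slope_le hm hmem.1.le ha (h.pos t hmem) hya hB
    have hB0 : 0 < B := ha.trans_le hB
    simp only [id]
    have h₂ : m / (2 * B) * (((2 : ℕ) : ℝ) * (t - a) ^ (2 - 1) * 1) = m / B * (t - a) := by
      field_simp; norm_num
    rw [h₂]
    have := Real.exp_pos (m / (2 * B) * (t - a) ^ 2)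
    nlinarith)
  simpa using this

/-- In the fourth quadrant `(Y / X)² - 2M / X` does not increase. -/
theorem sq_velocity_le (h : IsRightArc m M X Y a b) (hm : 0 < m) (hM : 0 < M) (hab : a ≤ b)
    (ha : 0 < X a) (hb : 0 < X b) (hya : Y a ≤ 0) :
    Y b ^ 2 ≤ 2 * M * X b + (X b / X a) ^ 2 * Y a ^ 2 := by
  have hpos : ∀ t ∈ uIcc a b, 0 < X t := by
    rw [uIcc_of_le hab]; exact h.pos_Icc ha hb
  have hac : AbsolutelyContinuousOnInterval
      (fun t => (Y t * (X t)⁻¹) ^ 2 - 2 * M * (X t)⁻¹) a b :=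
    ((h.ac_slope hab ha hb).comp_contDiff (g := fun y => y ^ 2) (by fun_prop)).fun_sub
      ((h.acX.inv₀ hpos).const_mul (2 * M))
  have := hac.le_of_ae_deriv_nonpos hab (by
    filter_upwards [h.deriv] with t ht hmem
    obtain ⟨hX, g, hg, hY⟩ := ht hmem
    have hmem' := Ioo_subset_Icc_self hmem
    have hx := h.pos t hmem
    have hy := h.velocity_nonpos_of_nonpos hm hya t hmem'
    refine ⟨_, ?_, ((hasDerivAt_slope hX hY hx hy).fun_pow 2).fun_sub
      ((hX.fun_inv hx.ne').const_mul (2 * M))⟩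
    have : ((2 : ℕ) : ℝ) * (Y t * (X t)⁻¹) ^ (2 - 1) * (-g / X t) - 2 * M * (-Y t / X t ^ 2) =
        2 * (M - g) * Y t / X t ^ 2 := by
      simp only [Nat.cast_ofNat, Nat.add_one_sub_one, pow_one]
      field_simp
      ring
    rw [this]
    exact div_nonpos_of_nonpos_of_nonneg
      (mul_nonpos_of_nonneg_of_nonpos (by linarith [hg.2]) hy) (sq_nonneg _))
  have hMa : 0 ≤ 2 * M * (X a)⁻¹ := by positivity
  have h₂ : (Y b * (X b)⁻¹) ^ 2 ≤ 2 * M * (X b)⁻¹ + (Y a * (X a)⁻¹) ^ 2 := by linarith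
  calc Y b ^ 2 = (Y b * (X b)⁻¹) ^ 2 * X b ^ 2 := by field_simp
    _ ≤ (2 * M * (X b)⁻¹ + (Y a * (X a)⁻¹) ^ 2) * X b ^ 2 := by gcongr
    _ = _ := by field_simp

/-- An arc that reaches the line `X = 0` does so at the origin: it stays below a parabola
`Y² = C X`. -/
theorem velocity_eq_zero (h : IsRightArc m M X Y a b) (hm : 0 < m) (hab : a ≤ b) (ha : 0 < X a)
    (hb : X b = 0) : Y b = 0 := by
  have := h.sq_sub_le hm hab (le_max_left (2 * M) (Y a ^ 2 / X a))
  rw [hb, max_eq_right (a := Y a ^ 2 - _)] at this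
  · nlinarith
  · rw [sub_nonpos, ← div_le_iff₀ ha]
    exact le_max_right _ _

end IsRightArc

/-! ### The Filippov set -/

section Filippov

variable {E : Type*} [NormedAddCommGroup E] [NormedSpace ℝ E] [MeasureSpace E]

theorem filippovSet_subset_of_forall_mem {g : E → E} {x : E} {r : ℝ} (hr : 0 < r) {C : Set E}
    (hconv : Convex ℝ C) (hcl : IsClosed C) (hg : ∀ y ∈ Metric.ball x r, g y ∈ C) :
    filippovSet g x ⊆ C := by
  intro v hv
  simp only [filippovSet, mem_iInter] at hv
  refine closedConvexHull_min ?_ hconv hcl (hv r hr ∅ measure_empty)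
  rintro _ ⟨y, hy, rfl⟩
  exact hg y hy.1

theorem filippovSet_subset_singleton {g : E → E} {x : E} (hg : ContinuousAt g x) :
    filippovSet g x ⊆ {g x} := by
  intro v hv
  rw [mem_singleton_iff, ← dist_le_zero]
  refine le_of_forall_pos_le_add fun ε hε => ?_
  rw [zero_add]
  obtain ⟨r, hr, h⟩ := Metric.continuousAt_iff.1 hg ε hε
  exact filippovSet_subset_of_forall_mem hr (convex_closedBall (g x) ε) Metric.isClosed_closedBall
    (fun y hy => (h hy).le) hv

/-- A value `v` belongs to the Filippov set at `x` if arbitrarily close to `x` there are points of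
continuity of `g` where `g` is arbitrarily close to `v`. -/
theorem mem_filippovSet_of_frequently [(volume : Measure E).IsOpenPosMeasure] {g : E → E} {x v : E}
    (h : ∀ ε > 0, ∃ y, dist y x < ε ∧ ContinuousAt g y ∧ dist (g y) v < ε) :
    v ∈ filippovSet g x := by
  simp only [filippovSet, mem_iInter]
  intro r hr N hN
  refine closure_subset_closedConvexHull (Metric.mem_closure_iff.2 fun ε hε => ?_)
  obtain ⟨y, hyx, hgy, hgv⟩ := h (min r ε) (lt_min hr hε)
  have h₁ : ∀ᶠ z in nhds y, dist z x < r :=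
    Metric.isOpen_ball.eventually_mem (hyx.trans_le (min_le_left _ _))
  have h₂ : ∀ᶠ z in nhds y, dist (g z) v < ε :=
    hgy.eventually (Metric.isOpen_ball.eventually_mem (hgv.trans_le (min_le_right _ _)))
  have hdense : Dense Nᶜ := Measure.dense_of_ae (compl_mem_ae_iff.2 hN)
  obtain ⟨z, hzN, hz⟩ :=
    ((mem_closure_iff_frequently.1 (hdense y)).and_eventually (h₁.and h₂)).exists
  exact ⟨g z, ⟨z, ⟨hz.1, hzN⟩, rfl⟩, by rw [dist_comm]; exact hz.2⟩

theorem mem_filippovSet_of_continuousAt [(volume : Measure E).IsOpenPosMeasure] {g : E → E} {x : E}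
    (hg : ContinuousAt g x) : g x ∈ filippovSet g x :=
  mem_filippovSet_of_frequently fun ε hε => ⟨x, by simpa using hε, hg, by simpa using hε⟩

end Filippov

/-! ### Filippov sets of the closed loop -/

section ClosedLoop

/-- The state plane. -/
abbrev Plane := EuclideanSpace ℝ (Fin 2)

variable {γ : ℝ} {d : ℝ → ℝ} {t : ℝ}

theorem damping_of_pos {x : Plane} (hx : 0 < x 0) : damping x = -(min (x 1) 0 ^ 2 / x 0) := by
  unfold damping
  rcases lt_or_ge (x 1) 0 with hy | hy
  · rw [if_pos (mul_neg_of_pos_of_neg hx hy), abs_of_neg hy, abs_of_pos hx, min_eq_left hy.le]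
    ring
  · rw [if_neg (mul_nonneg hx.le hy).not_gt, min_eq_right hy]
    simp

theorem damping_neg (x : Plane) : damping (-x) = -damping x := by
  simp [damping, neg_ite]

theorem feedbackLaw_neg (x : Plane) : feedbackLaw γ (-x) = -feedbackLaw γ x := by
  simp only [feedbackLaw, damping_neg, PiLp.neg_apply, Real.sign_neg]
  ring

theorem feedbackLaw_of_pos {x : Plane} (hx : 0 < x 0) :
    feedbackLaw γ x = -γ + min (x 1) 0 ^ 2 / x 0 := by
  simp only [feedbackLaw, Real.sign_of_pos hx, damping_of_pos hx]
  ring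

theorem continuousAt_feedbackLaw {x : Plane} (hx : x 0 ≠ 0) : ContinuousAt (feedbackLaw γ) x := by
  have key : ∀ y : Plane, 0 < y 0 → ContinuousAt (feedbackLaw γ) y := by
    intro y hy
    have hev : feedbackLaw γ =ᶠ[nhds y] fun z => -γ + min (z 1) 0 ^ 2 / z 0 := by
      have hc : Continuous fun z : Plane => z 0 := by fun_prop
      filter_upwards [hc.continuousAt.eventually (lt_mem_nhds hy)] with z hz
      exact feedbackLaw_of_pos hz
    refine ContinuousAt.congr ?_ hev.symm
    have : y 0 ≠ 0 := hy.ne'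
    fun_prop (disch := assumption)
  rcases hx.lt_or_gt with h | h
  · have h₁ : feedbackLaw γ = fun z => -feedbackLaw γ (-z) := by
      funext z; rw [feedbackLaw_neg, neg_neg]
    rw [h₁]
    have h₂ : ContinuousAt (feedbackLaw γ) (-x) := key (-x) (by simpa using h)
    exact (ContinuousAt.comp (f := fun z : Plane => -z) h₂ continuous_neg.continuousAt).neg
  · exact key x h

theorem continuousAt_closedLoop {x : Plane} (hx : x 0 ≠ 0) :
    ContinuousAt (closedLoop γ d t) x := by
  have h := continuousAt_feedbackLaw (γ := γ) hx
  have h₁ : Continuous fun p : ℝ × ℝ => (!₂[p.1, p.2] : Plane) := by fun_prop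
  have h₂ : ContinuousAt (fun y : Plane => (y 1, feedbackLaw γ y + d t)) x :=
    ContinuousAt.prodMk (by fun_prop) (h.add continuousAt_const)
  exact ContinuousAt.comp (g := fun p : ℝ × ℝ => (!₂[p.1, p.2] : Plane)) h₁.continuousAt h₂

theorem filippovSet_closedLoop_fst {x v : Plane} (hv : v ∈ filippovSet (closedLoop γ d t) x) :
    v 0 = x 1 := by
  rw [← dist_le_zero]
  refine le_of_forall_pos_le_add fun ε hε => ?_
  rw [zero_add]
  have hC : IsClosed {v : Plane | v 0 ∈ Metric.closedBall (x 1) ε} :=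
    Metric.isClosed_closedBall.preimage (by fun_prop)
  have hconv : Convex ℝ {v : Plane | v 0 ∈ Metric.closedBall (x 1) ε} :=
    (convex_closedBall (x 1) ε).linear_preimage
      (EuclideanSpace.proj (𝕜 := ℝ) (0 : Fin 2)).toLinearMap
  refine filippovSet_subset_of_forall_mem hε hconv hC (fun y hy => ?_) hv
  have h₁ : dist (y 1) (x 1) ≤ dist y x := by
    rw [dist_eq_norm, dist_eq_norm]
    exact PiLp.norm_apply_le (y - x) 1
  simpa [closedLoop] using h₁.trans (Metric.mem_ball.1 hy).le

/-- The origin is an equilibrium: along the parabola `(x 1)² = (γ - d) (x 0)` in the fourth quadrant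
the damping compensates the rest of the control, so that the field tends to zero there. -/
theorem zero_mem_filippovSet_closedLoop (hd : |d t| < γ) :
    (0 : Plane) ∈ filippovSet (closedLoop γ d t) 0 := by
  have hg : 0 < γ - d t := by linarith [(abs_lt.1 hd).2]
  refine mem_filippovSet_of_frequently fun ε hε => ?_
  have hc : Continuous fun s : ℝ => (!₂[s ^ 2, -(Real.sqrt (γ - d t) * s)] : Plane) := by fun_prop
  have hc' : Continuous fun s : ℝ => (!₂[-(Real.sqrt (γ - d t) * s), 0] : Plane) := by fun_prop
  have h₁ := hc.tendsto' 0 0 (by ext i; fin_cases i <;> simp)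
  have h₂ := hc'.tendsto' 0 0 (by ext i; fin_cases i <;> simp)
  have hev := ((h₁.eventually (Metric.ball_mem_nhds 0 hε)).and
    (h₂.eventually (Metric.ball_mem_nhds 0 hε))).filter_mono (nhdsWithin_le_nhds (s := Ioi 0))
  obtain ⟨s, ⟨hs₁, hs₂⟩, hs⟩ := (hev.and self_mem_nhdsWithin).exists
  have hs : 0 < s := hs
  have hpos : 0 < (!₂[s ^ 2, -(Real.sqrt (γ - d t) * s)] : Plane) 0 := by simp; positivity
  refine ⟨_, hs₁, continuousAt_closedLoop hpos.ne', ?_⟩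
  convert! hs₂ using 2
  have hneg : -(Real.sqrt (γ - d t) * s) ≤ 0 := by simp; positivity
  rw [closedLoop, feedbackLaw_of_pos hpos]
  ext i
  fin_cases i
  · simp
  · simp only [Fin.mk_one, Fin.isValue, Matrix.cons_val_one, Matrix.cons_val_fin_one,
      Matrix.cons_val_zero, min_eq_left hneg]
    rw [neg_sq, mul_pow, Real.sq_sqrt hg.le]
    field_simp
    ring

/-! ### Arcs of the differential inclusion -/

/-- An absolutely continuous arc that satisfies, away from the line `x 0 = 0`, the differential
inclusion obtained by letting the disturbance range over `[-D, D]`. On the line itself only the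
kinematic equation `(x 0)' = x 1` is retained. -/
structure IsInclusionArc (γ D : ℝ) (x : ℝ → Plane) (a b : ℝ) : Prop where
  ac : AbsolutelyContinuousOnInterval x a b
  deriv : ∀ᵐ t, t ∈ Ioo a b → ∃ v, HasDerivAt x v t ∧ v 0 = x t 1 ∧
    (x t 0 ≠ 0 → ∃ δ, |δ| ≤ D ∧ v 1 = feedbackLaw γ (x t) + δ)

theorem IsFilippovSolutionOn.isInclusionArc {D : ℝ} (hd : IsAdmissibleDisturbance D d)
    {x : ℝ → Plane} {J : Set ℝ} (hJ : MeasurableSet J)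
    (hx : IsFilippovSolutionOn (closedLoop γ d) x J) {a b : ℝ} (ha : 0 ≤ a) (hab : a ≤ b)
    (hsub : Icc a b ⊆ J) : IsInclusionArc γ D x a b := by
  refine ⟨hx.1 a b hab hsub, ?_⟩
  filter_upwards [(ae_restrict_iff' hJ).1 hx.2, (ae_restrict_iff' measurableSet_Ici).1 hd.2]
    with t h₁ h₂ ht
  obtain ⟨v, hv, hderiv⟩ := h₁ (hsub (Ioo_subset_Icc_self ht))
  refine ⟨v, hderiv, filippovSet_closedLoop_fst hv, fun h0 => ⟨d t, h₂ (ha.trans ht.1.le), ?_⟩⟩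
  rw [filippovSet_subset_singleton (continuousAt_closedLoop h0) hv]
  simp [closedLoop]

theorem AbsolutelyContinuousOnInterval.euclidean_apply {x : ℝ → Plane} {a b : ℝ}
    (h : AbsolutelyContinuousOnInterval x a b) (i : Fin 2) :
    AbsolutelyContinuousOnInterval (fun t => x t i) a b :=
  h.comp_lipschitzOnWith (g := fun y : Plane => y i)
    ((EuclideanSpace.proj (𝕜 := ℝ) i).lipschitz.lipschitzOnWith)

theorem HasDerivAt.euclidean_apply {x : ℝ → Plane} {v : Plane} {t : ℝ} (h : HasDerivAt x v t)
    (i : Fin 2) : HasDerivAt (fun t => x t i) (v i) t :=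
  (EuclideanSpace.proj (𝕜 := ℝ) i).hasFDerivAt.comp_hasDerivAt t h

namespace IsInclusionArc

variable {D : ℝ} {x : ℝ → Plane} {a b : ℝ}

theorem mono (h : IsInclusionArc γ D x a b) {c e : ℝ} (hac : a ≤ c) (hce : c ≤ e) (heb : e ≤ b) :
    IsInclusionArc γ D x c e := by
  refine ⟨h.ac.mono ?_, ?_⟩
  · rw [uIcc_of_le hce, uIcc_of_le (hac.trans (hce.trans heb))]
    exact Icc_subset_Icc hac heb
  · filter_upwards [h.deriv] with t ht hmem
    exact ht (Ioo_subset_Ioo hac heb hmem)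

theorem neg (h : IsInclusionArc γ D x a b) : IsInclusionArc γ D (fun t => -x t) a b := by
  refine ⟨h.ac.fun_neg, ?_⟩
  filter_upwards [h.deriv] with t ht hmem
  obtain ⟨v, hd, h0, h1⟩ := ht hmem
  refine ⟨-v, hd.fun_neg, by simp [h0], fun hne => ?_⟩
  obtain ⟨δ, hδ, hv⟩ := h1 (by simpa using hne)
  exact ⟨-δ, by simpa using hδ, by rw [feedbackLaw_neg, PiLp.neg_apply, hv]; ring⟩

theorem continuousOn_apply (h : IsInclusionArc γ D x a b) (hab : a ≤ b) (i : Fin 2) :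
    ContinuousOn (fun t => x t i) (Icc a b) := by
  simpa [uIcc_of_le hab] using (h.ac.euclidean_apply i).continuousOn

theorem isRightArc (h : IsInclusionArc γ D x a b) (hpos : ∀ t ∈ Ioo a b, 0 < x t 0) :
    IsRightArc (γ - D) (γ + D) (fun t => x t 0) (fun t => x t 1) a b := by
  refine ⟨h.ac.euclidean_apply 0, h.ac.euclidean_apply 1, hpos, ?_⟩
  filter_upwards [h.deriv] with t ht hmem
  obtain ⟨v, hd, h0, h1⟩ := ht hmem
  obtain ⟨δ, hδ, hv⟩ := h1 (hpos t hmem).ne'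
  refine ⟨(hd.euclidean_apply 0).congr_deriv h0, γ - δ, ?_,
    (hd.euclidean_apply 1).congr_deriv ?_⟩
  · constructor <;> linarith [abs_le.1 hδ]
  · rw [hv, feedbackLaw_of_pos (hpos t hmem)]; ring

/-- Arcs do not cross the line `x 0 = 0`: at a positive time they can meet it at the origin only. -/
theorem eq_zero_of_position_eq_zero (h : IsInclusionArc γ D x a b) (hm : 0 < γ - D) (hab : a < b)
    (hb : x b 0 = 0) : x b = 0 := by
  have key : ∀ y : ℝ → Plane, IsInclusionArc γ D y a b → y b 0 = 0 → ¬ y b 1 < 0 := by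
    intro y hy hb hneg
    have hev : ∀ᶠ t in nhdsWithin b (Iio b), y t 1 < 0 ∧ a < t := by
      have := (hy.continuousOn_apply hab.le 1) b (right_mem_Icc.2 hab.le)
      have h₁ : ∀ᶠ t in nhdsWithin b (Icc a b), y t 1 < 0 := this.eventually (gt_mem_nhds hneg)
      rw [nhdsWithin_Icc_eq_nhdsLE hab] at h₁
      exact (h₁.filter_mono (nhdsWithin_mono _ Iio_subset_Iic_self)).and
        (nhdsWithin_le_nhds (lt_mem_nhds hab))
    obtain ⟨c, hcb, hc⟩ := (mem_nhdsLT_iff_exists_Ioo_subset).1 hev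
    have hcb : c < b := hcb
    set e := (c + b) / 2
    have hce : c < e := by simp only [e]; linarith
    have heb : e < b := by simp only [e]; linarith
    have hae : a < e := (hc ⟨hce, heb⟩).2
    have hpos : ∀ t ∈ Ico e b, 0 < y t 0 := by
      intro t ht
      have htb : t < b := ht.2
      -- the velocity has a negative maximum on `[t, b]`, so the position strictly decreases to zero
      have hcont := (hy.mono (hae.le.trans ht.1) htb.le le_rfl).continuousOn_apply htb.le 1
      obtain ⟨s, hs, hmax⟩ := isCompact_Icc.exists_isMaxOn (nonempty_Icc.2 htb.le) hcont
      have hsneg : y s 1 < 0 := by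
        rcases eq_or_lt_of_le hs.2 with h | h
        · rw [h]; exact hneg
        · exact (hc ⟨hce.trans_le (ht.1.trans hs.1), h⟩).1
      have hy' := hy.mono (hae.le.trans ht.1) htb.le le_rfl
      have hac : AbsolutelyContinuousOnInterval (fun u => y u 0 - y s 1 * u) t b :=
        (hy'.ac.euclidean_apply 0).fun_sub (.of_contDiff (by fun_prop) t b)
      have := hac.le_of_ae_deriv_nonpos htb.le (by
        filter_upwards [hy'.deriv] with u hu hmem
        obtain ⟨v, hd, h0, -⟩ := hu hmem
        refine ⟨_, ?_, (hd.euclidean_apply 0).fun_sub ((hasDerivAt_id u).const_mul (y s 1))⟩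
        have := hmax (Ioo_subset_Icc_self hmem)
        simp only [mem_ofPred_eq] at this
        rw [h0]; linarith)
      simp only [hb] at this
      nlinarith
    have harc := (hy.mono hae.le heb.le le_rfl).isRightArc
      fun t ht => hpos t (Ioo_subset_Ico_self ht)
    exact hneg.ne (harc.velocity_eq_zero hm heb.le (hpos e ⟨le_rfl, heb⟩) hb)
  have h1 : x b 1 = 0 := by
    refine le_antisymm ?_ (not_lt.1 (key x h hb))
    have := key _ h.neg (by simpa using hb)
    simpa using this
  ext i
  fin_cases i
  · exact hb
  · exact h1

/-- The position keeps a strict sign between two zeros. -/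
theorem pos_or_neg (h : IsInclusionArc γ D x a b) (hab : a ≤ b)
    (hne : ∀ t ∈ Ioo a b, x t 0 ≠ 0) :
    (∀ t ∈ Ioo a b, 0 < x t 0) ∨ (∀ t ∈ Ioo a b, x t 0 < 0) := by
  by_contra! hcon
  obtain ⟨⟨s, hs, hs0⟩, ⟨t, ht, ht0⟩⟩ := hcon
  have hc := (h.continuousOn_apply hab 0).mono Ioo_subset_Icc_self
  obtain ⟨u, hu, hu0⟩ := (isPreconnected_Ioo (a := a) (b := b)).intermediate_value hs ht hc
    ⟨hs0, ht0⟩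
  exact hne u hu hu0

/-- The origin is absorbing. -/
theorem eq_zero_of_eq_zero (h : IsInclusionArc γ D x a b) (hm : 0 < γ - D) (hab : a ≤ b)
    (ha : x a = 0) : x b = 0 := by
  have hcl : IsClosed {t ∈ Icc a b | x t 0 = 0} :=
    (h.continuousOn_apply hab 0).preimage_isClosed_of_isClosed isClosed_Icc isClosed_singleton
  have hbd : BddAbove {t ∈ Icc a b | x t 0 = 0} := ⟨b, fun t ht => ht.1.2⟩
  have hs := hcl.csSup_mem ⟨a, left_mem_Icc.2 hab, by simp [ha]⟩ hbd
  set s := sSup {t ∈ Icc a b | x t 0 = 0}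
  -- the arc is at the origin at the last time `s` when it is on the line
  have hs0 : x s = 0 := by
    rcases eq_or_lt_of_le hs.1.1 with h' | h'
    · rw [← h']; exact ha
    · exact (h.mono le_rfl hs.1.1 hs.1.2).eq_zero_of_position_eq_zero hm h' hs.2
  rcases eq_or_lt_of_le hs.1.2 with h' | hsb
  · rwa [← h']
  have harc := h.mono hs.1.1 hs.1.2 le_rfl
  have hne : ∀ t ∈ Ioo s b, x t 0 ≠ 0 := fun t ht h0 =>
    ht.1.not_ge (le_csSup hbd ⟨⟨hs.1.1.trans ht.1.le, ht.2.le⟩, h0⟩)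
  have key : ∀ y : ℝ → Plane, IsInclusionArc γ D y s b → y s = 0 → (∀ t ∈ Ioo s b, 0 < y t 0) →
      y b 0 = 0 := by
    intro y hy hys hpos
    have hr := hy.isRightArc hpos
    have h₁ := hr.energy_le hm hsb.le
    have h₂ := hr.nonneg_right hsb
    simp only [hys, PiLp.zero_apply, max_self] at h₁
    nlinarith [sq_nonneg (max (y b 1) 0)]
  have hb : x b 0 = 0 := by
    rcases harc.pos_or_neg hsb.le hne with hp | hp
    · exact key x harc hs0 hp
    · simpa using key _ harc.neg (by simp [hs0]) (by simpa using hp)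
  exact (h.mono hs.1.1 hs.1.2 le_rfl).eq_zero_of_position_eq_zero hm hsb hb

/-- An arc that does not end at the origin stays in an open half-plane, except possibly at
the initial time. -/
theorem exists_sign (h : IsInclusionArc γ D x a b) (hm : 0 < γ - D) (hab : a < b)
    (hb : x b ≠ 0) : (∀ t ∈ Ioc a b, 0 < x t 0) ∨ (∀ t ∈ Ioc a b, x t 0 < 0) := by
  have hne : ∀ t ∈ Ioc a b, x t 0 ≠ 0 := fun t ht h0 =>
    hb ((h.mono ht.1.le ht.2 le_rfl).eq_zero_of_eq_zero hm ht.2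
      ((h.mono le_rfl ht.1.le ht.2).eq_zero_of_position_eq_zero hm ht.1 h0))
  rcases h.pos_or_neg hab.le (fun t ht => hne t (Ioo_subset_Ioc_self ht)) with hp | hp
  · refine .inl fun t ht => ?_
    rcases eq_or_lt_of_le ht.2 with rfl | h'
    · exact ((h.isRightArc hp).nonneg_right hab).lt_of_ne' (hne t ht)
    · exact hp t ⟨ht.1, h'⟩
  · refine .inr fun t ht => ?_
    rcases eq_or_lt_of_le ht.2 with rfl | h'
    · have := (h.neg.isRightArc (by simpa using hp)).nonneg_right hab
      exact (by simpa using this : x t 0 ≤ 0).lt_of_ne (hne t ht)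
    · exact hp t ⟨ht.1, h'⟩

end IsInclusionArc

end ClosedLoop

/-! ### Stability and attraction estimates -/

section Estimates

variable {γ D : ℝ} {x : ℝ → Plane} {a b : ℝ}

theorem Plane.norm_sq (v : Plane) : ‖v‖ ^ 2 = v 0 ^ 2 + v 1 ^ 2 := by
  rw [EuclideanSpace.real_norm_sq_eq, Fin.sum_univ_two]

theorem Plane.abs_apply_le {v : Plane} {r : ℝ} (hv : ‖v‖ ≤ r) (i : Fin 2) : |v i| ≤ r :=
  (PiLp.norm_apply_le v i).trans hv

namespace IsInclusionArc

theorem bounds (h : IsInclusionArc γ D x a b) (hm : 0 < γ - D) (hM : 0 ≤ γ + D) (hab : a ≤ b) :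
    (γ - D) * |x b 0| ≤ (γ - D) * |x a 0| + x a 1 ^ 2 / 2 ∧
      x b 1 ^ 2 ≤ 2 * (γ + D) * |x b 0| + x a 1 ^ 2 := by
  rcases eq_or_lt_of_le hab with rfl | hab
  · constructor
    · nlinarith [sq_nonneg (x a 1)]
    · have := abs_nonneg (x a 0)
      nlinarith
  by_cases hb : x b = 0
  · simp only [hb, PiLp.zero_apply, abs_zero, mul_zero]
    constructor
    · positivity
    · nlinarith [sq_nonneg (x a 1)]
  have key : ∀ y : ℝ → Plane, IsInclusionArc γ D y a b → (∀ t ∈ Ioc a b, 0 < y t 0) →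
      (γ - D) * |y b 0| ≤ (γ - D) * |y a 0| + y a 1 ^ 2 / 2 ∧
      y b 1 ^ 2 ≤ 2 * (γ + D) * |y b 0| + y a 1 ^ 2 := by
    intro y hy hpos
    have hr := hy.isRightArc fun t ht => hpos t (Ioo_subset_Ioc_self ht)
    have h₀ := hr.nonneg_left hab
    have h₁ := hr.energy_le hm hab.le
    have h₂ := hr.sq_sub_le hm hab.le le_rfl
    rw [abs_of_pos (hpos b ⟨hab, le_rfl⟩), abs_of_nonneg h₀]
    have h₃ : max (y a 1) 0 ^ 2 ≤ y a 1 ^ 2 := by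
      rcases le_total (y a 1) 0 with h | h
      · rw [max_eq_right h]; nlinarith
      · rw [max_eq_left h]
    constructor
    · nlinarith [sq_nonneg (max (y b 1) 0)]
    · have h₄ : max (y a 1 ^ 2 - 2 * (γ + D) * y a 0) 0 ≤ y a 1 ^ 2 :=
        max_le (by nlinarith) (sq_nonneg _)
      linarith
  rcases h.exists_sign hm hab hb with hp | hp
  · exact key x h hp
  · simpa using key _ h.neg (by simpa using hp)

theorem abs_position_le (h : IsInclusionArc γ D x a b) (hm : 0 < γ - D) (hM : 0 ≤ γ + D)
    (hab : a ≤ b) {r : ℝ} (hr : ‖x a‖ ≤ r) : |x b 0| ≤ r + r ^ 2 / (2 * (γ - D)) := by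
  have h₁ := (h.bounds hm hM hab).1
  have h₂ := Plane.abs_apply_le hr 0
  have h₃ := sq_le_sq' (abs_le.1 (Plane.abs_apply_le hr 1)).1 (abs_le.1 (Plane.abs_apply_le hr 1)).2
  have h₄ : (γ - D) * |x b 0| ≤ (γ - D) * (r + r ^ 2 / (2 * (γ - D))) := by
    have : (γ - D) * (r + r ^ 2 / (2 * (γ - D))) = (γ - D) * r + r ^ 2 / 2 := by field_simp
    rw [this]
    nlinarith
  exact le_of_mul_le_mul_left h₄ hm

/-- A bound of the state by the initial state, of order `√‖x a‖` near the origin. -/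
theorem norm_sq_le (h : IsInclusionArc γ D x a b) (hm : 0 < γ - D) (hM : 0 ≤ γ + D)
    (hab : a ≤ b) {r : ℝ} (hr : ‖x a‖ ≤ r) :
    ‖x b‖ ^ 2 ≤ (r + r ^ 2 / (2 * (γ - D))) ^ 2 +
      2 * (γ + D) * (r + r ^ 2 / (2 * (γ - D))) + r ^ 2 := by
  have h₁ := h.abs_position_le hm hM hab hr
  have h₂ := (h.bounds hm hM hab).2
  have h₃ := sq_le_sq' (abs_le.1 (Plane.abs_apply_le hr 1)).1 (abs_le.1 (Plane.abs_apply_le hr 1)).2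
  have h₄ := sq_le_sq' (abs_le.1 h₁).1 (abs_le.1 h₁).2
  rw [Plane.norm_sq]
  nlinarith

/-- Once the initial velocity has been spent, the state decays at a Gaussian rate. -/
theorem norm_sq_le_exp (h : IsInclusionArc γ D x a b) (hm : 0 < γ - D) (hM : 0 < γ + D) {r B : ℝ}
    (hr0 : 0 < r) (hr : ‖x a‖ ≤ r) (hB : B = r + r ^ 2 / (2 * (γ - D)))
    (hab : a + r / (γ - D) ≤ b) :
    ‖x b‖ ^ 2 ≤ (B ^ 2 + 4 * (γ + D) * B + r ^ 2) *
      Real.exp (-((γ - D) / (2 * B) * (b - (a + r / (γ - D))) ^ 2)) := by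
  have hB0 : 0 < B := by rw [hB]; positivity
  have hlen : 0 < r / (γ - D) := by positivity
  set c := a + r / (γ - D) with hc
  have hac : a < c := by linarith
  by_cases hb : x b = 0
  · rw [hb, norm_zero, zero_pow two_ne_zero]; positivity
  have key : ∀ y : ℝ → Plane, IsInclusionArc γ D y a b → ‖y a‖ ≤ r →
      (∀ t ∈ Ioc a b, 0 < y t 0) → y b 0 ^ 2 + y b 1 ^ 2 ≤ (B ^ 2 + 4 * (γ + D) * B + r ^ 2) *
      Real.exp (-((γ - D) / (2 * B) * (b - c) ^ 2)) := by
    intro y hy hyr hpos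
    have hyc := hy.mono le_rfl hac.le hab
    have hyb := hy.mono hac.le hab le_rfl
    have hr₁ := hyc.isRightArc fun t ht => hpos t ⟨ht.1, ht.2.le.trans hab⟩
    have hr₂ := hyb.isRightArc fun t ht => hpos t ⟨hac.trans ht.1, ht.2.le⟩
    have hvel : y c 1 ≤ 0 := by
      refine hr₁.velocity_nonpos hm hac.le ?_
      rw [hc, add_sub_cancel_left, mul_div_cancel₀ _ hm.ne']
      exact (abs_le.1 (Plane.abs_apply_le hyr 1)).2
    have hXc : y c 0 ≤ B := by
      rw [hB]; exact (le_abs_self _).trans (hyc.abs_position_le hm hM.le hac.le hyr)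
    have hXc0 : 0 < y c 0 := hpos c ⟨hac, hab⟩
    have hXb0 : 0 < y b 0 := hpos b ⟨hac.trans_le hab, le_rfl⟩
    have hYc : y c 1 ^ 2 ≤ 2 * (γ + D) * B + r ^ 2 := by
      have h₁ := (hyc.bounds hm hM.le hac.le).2
      have h₂ := Plane.abs_apply_le hyr 1
      have h₃ := sq_le_sq' (abs_le.1 h₂).1 (abs_le.1 h₂).2
      rw [abs_of_pos hXc0] at h₁
      nlinarith
    have hexp := hr₂.position_mul_exp_le hm hab hXc0 hvel hXc
    have hY := hr₂.sq_velocity_le hm hM hab hXc0 hXb0 hvel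
    set E := (γ - D) / (2 * B) * (b - c) ^ 2 with hE
    have hE0 : 0 ≤ E := by positivity
    have he1 : Real.exp (-E) ≤ 1 := Real.exp_le_one_iff.2 (by linarith)
    have he0 := Real.exp_pos (-E)
    have hXb : y b 0 ≤ y c 0 * Real.exp (-E) := by
      rw [Real.exp_neg, ← div_eq_mul_inv, le_div_iff₀ (Real.exp_pos _)]
      exact hexp
    have hq : y b 0 / y c 0 ≤ Real.exp (-E) := by
      rw [div_le_iff₀ hXc0]; linarith
    have hq2 : (y b 0 / y c 0) ^ 2 ≤ Real.exp (-E) := by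
      have hq0 : 0 ≤ y b 0 / y c 0 := by positivity
      nlinarith
    have hXbB : y b 0 ≤ B * Real.exp (-E) := hXb.trans (by gcongr)
    have hXb2 : y b 0 ^ 2 ≤ B ^ 2 * Real.exp (-E) := by
      calc y b 0 ^ 2 ≤ (B * Real.exp (-E)) ^ 2 := by gcongr
        _ = B ^ 2 * (Real.exp (-E) * Real.exp (-E)) := by ring
        _ ≤ B ^ 2 * (Real.exp (-E) * 1) := by gcongr
        _ = _ := by ring
    have hYb : y b 1 ^ 2 ≤ 2 * (γ + D) * (B * Real.exp (-E)) +
        Real.exp (-E) * (2 * (γ + D) * B + r ^ 2) := by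
      refine hY.trans ?_
      gcongr
    linarith
  rw [Plane.norm_sq]
  rcases h.exists_sign hm (hac.trans_le hab) hb with hp | hp
  · exact key x h hr hp
  · simpa using key _ h.neg (by simpa using hr) (by simpa using hp)

end IsInclusionArc

/-- A function of class `K∞` that inverts the growth bound `r + r⁴`, up to constants. -/
theorem isClassKInfty_sqrt_sqrt {K : ℝ} (hK : 0 < K) :
    IsClassKInfty fun ε => Real.sqrt (Real.sqrt (1 + ε ^ 2 / K)) - 1 where
  continuousOn := by fun_prop
  strictMonoOn := by
    intro s hs t ht hst
    have hs : 0 ≤ s := hs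
    have h : 1 + s ^ 2 / K < 1 + t ^ 2 / K := by gcongr
    exact sub_lt_sub_right
      (Real.sqrt_lt_sqrt (Real.sqrt_nonneg _) (Real.sqrt_lt_sqrt (by positivity) h)) 1
  map_zero := by simp
  tendsto_atTop := by
    have h : Tendsto (fun ε : ℝ => 1 + ε ^ 2 / K) atTop atTop :=
      tendsto_atTop_add_const_left _ _ ((tendsto_pow_atTop two_ne_zero).atTop_div_const hK)
    exact tendsto_atTop_add_const_right _ (-1)
      (Real.tendsto_sqrt_atTop.comp (Real.tendsto_sqrt_atTop.comp h))

theorem exists_stability_gain (hm : 0 < γ - D) (hM : 0 ≤ γ + D) :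
    ∃ α : ℝ → ℝ, IsClassKInfty α ∧ ∀ ε : ℝ, 0 ≤ ε → ∀ (x : ℝ → Plane) (a b : ℝ),
      IsInclusionArc γ D x a b → a ≤ b → ‖x a‖ ≤ α ε → ‖x b‖ ≤ ε := by
  set k := 1 / (2 * (γ - D)) with hk
  have hk0 : 0 < k := by positivity
  set M := γ + D
  have hK : 0 < 3 + 2 * M * k + 2 * k ^ 2 + 2 * M := by positivity
  refine ⟨_, isClassKInfty_sqrt_sqrt hK, fun ε hε x a b h hab hx => ?_⟩
  set K := 3 + 2 * M * k + 2 * k ^ 2 + 2 * M with hKdef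
  set s := Real.sqrt (Real.sqrt (1 + ε ^ 2 / K)) - 1 with hs
  have hs0 : 0 ≤ s := (norm_nonneg _).trans hx
  have hs4 : (1 + s) ^ 4 = 1 + ε ^ 2 / K := by
    have : (1 + s) ^ 4 = ((Real.sqrt (Real.sqrt (1 + ε ^ 2 / K))) ^ 2) ^ 2 := by
      rw [hs]; ring
    rw [this, Real.sq_sqrt (Real.sqrt_nonneg _), Real.sq_sqrt (by positivity)]
  have hsK : K * (s + s ^ 4) ≤ ε ^ 2 := by
    have h₁ : s + s ^ 4 ≤ (1 + s) ^ 4 - 1 := by nlinarith [pow_nonneg hs0 3, pow_nonneg hs0 2]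
    calc K * (s + s ^ 4) ≤ K * ((1 + s) ^ 4 - 1) := by gcongr
      _ = ε ^ 2 := by rw [hs4]; field_simp; ring
  have hb := h.norm_sq_le hm hM hab hx
  have hdiv : s ^ 2 / (2 * (γ - D)) = k * s ^ 2 := by rw [hk]; ring
  rw [hdiv] at hb
  have h24 : s ^ 2 ≤ s + s ^ 4 := by
    rcases le_total s 1 with h | h
    · nlinarith [pow_nonneg hs0 4]
    · nlinarith [mul_nonneg (sq_nonneg s) (by nlinarith : 0 ≤ s ^ 2 - 1)]
  have hfin : (s + k * s ^ 2) ^ 2 + 2 * M * (s + k * s ^ 2) + s ^ 2 ≤ K * (s + s ^ 4) := by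
    have e₁ : (s + k * s ^ 2) ^ 2 ≤ 2 * s ^ 2 + 2 * k ^ 2 * s ^ 4 := by
      nlinarith [sq_nonneg (s - k * s ^ 2)]
    have e₂ : (3 + 2 * M * k) * s ^ 2 ≤ (3 + 2 * M * k) * (s + s ^ 4) := by gcongr
    have e₃ : 0 ≤ 2 * k ^ 2 * s := by positivity
    have e₄ : 0 ≤ 2 * M * s ^ 4 := by positivity
    rw [hKdef]
    linarith
  exact abs_le_of_sq_le_sq' (hb.trans (hfin.trans hsK)) hε |>.2

theorem exists_attraction_time (hm : 0 < γ - D) (hM : 0 < γ + D) {r ε : ℝ} (hr : 0 < r)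
    (hε : 0 < ε) : ∃ T : ℝ, 0 < T ∧ ∀ (x : ℝ → Plane) (a b : ℝ),
      IsInclusionArc γ D x a b → ‖x a‖ ≤ r → a + T ≤ b → ‖x b‖ < ε := by
  set B := r + r ^ 2 / (2 * (γ - D)) with hB
  have hB0 : 0 < B := by positivity
  set c := (γ - D) / (2 * B)
  have hc : 0 < c := by positivity
  set Q := B ^ 2 + 4 * (γ + D) * B + r ^ 2
  have hlim : Tendsto (fun s : ℝ => Q * Real.exp (-(c * s ^ 2))) atTop (nhds (Q * 0)) :=
    (Real.tendsto_exp_neg_atTop_nhds_zero.comp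
      ((tendsto_pow_atTop two_ne_zero).const_mul_atTop hc)).const_mul Q
  rw [mul_zero] at hlim
  obtain ⟨T₀, hT₀⟩ := eventually_atTop.1 (hlim.eventually (gt_mem_nhds (pow_pos hε 2)))
  have hlen : 0 < r / (γ - D) := by positivity
  refine ⟨r / (γ - D) + max T₀ 0, by positivity, fun x a b h hx hab => ?_⟩
  have h₁ : T₀ ≤ max T₀ 0 := le_max_left _ _
  have h₂ : 0 ≤ max T₀ 0 := le_max_right _ _
  have h₃ := h.norm_sq_le_exp hm hM hr hx hB (by linarith)
  exact lt_of_pow_lt_pow_left₀ 2 hε.le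
    (h₃.trans_lt (hT₀ (b - (a + r / (γ - D))) (by linarith)))

end Estimates

/-! ### Concatenation of Filippov solutions -/

namespace IsFilippovSolutionOn

variable {E : Type*} [NormedAddCommGroup E] [NormedSpace ℝ E] [MeasureSpace E]
  {f : ℝ → E → E} {x y : ℝ → E} {a b c : ℝ}

theorem mono {J K : Set ℝ} (h : IsFilippovSolutionOn f x J) (hKJ : K ⊆ J) :
    IsFilippovSolutionOn f x K :=
  ⟨fun a b hab hsub => h.1 a b hab (hsub.trans hKJ), ae_restrict_of_ae_restrict_of_subset hKJ h.2⟩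

theorem Icc_iff (hab : a ≤ b) : IsFilippovSolutionOn f x (Icc a b) ↔
    AbsolutelyContinuousOnInterval x a b ∧
      ∀ᵐ t, t ∈ Ioo a b → ∃ v ∈ filippovSet (f t) (x t), HasDerivAt x v t := by
  unfold IsFilippovSolutionOn
  rw [← Measure.restrict_congr_set Ioo_ae_eq_Icc, ae_restrict_iff' measurableSet_Ioo]
  refine and_congr_left fun _ => ⟨fun h => h a b hab le_rfl, fun h c d hcd hsub => h.mono ?_⟩
  rwa [uIcc_of_le hcd, uIcc_of_le hab]

theorem congr_Icc (hab : a ≤ b) (h : IsFilippovSolutionOn f x (Icc a b))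
    (hxy : EqOn x y (Icc a b)) : IsFilippovSolutionOn f y (Icc a b) := by
  rw [Icc_iff hab] at h ⊢
  refine ⟨h.1.congr (by rwa [uIcc_of_le hab]), ?_⟩
  filter_upwards [h.2] with t ht hmem
  obtain ⟨v, hv, hd⟩ := ht hmem
  rw [← hxy (Ioo_subset_Icc_self hmem)]
  refine ⟨v, hv, hd.congr_of_eventuallyEq ?_⟩
  filter_upwards [isOpen_Ioo.mem_nhds hmem] with u hu
  exact (hxy (Ioo_subset_Icc_self hu)).symm

theorem union_Icc (hab : a ≤ b) (hbc : b ≤ c) (h₁ : IsFilippovSolutionOn f x (Icc a b))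
    (h₂ : IsFilippovSolutionOn f x (Icc b c)) : IsFilippovSolutionOn f x (Icc a c) := by
  refine (Icc_iff (hab.trans hbc)).2
    ⟨.trans hab hbc (h₁.1 a b hab le_rfl) (h₂.1 b c hbc le_rfl), ?_⟩
  filter_upwards [((Icc_iff hab).1 h₁).2, ((Icc_iff hbc).1 h₂).2, Measure.ae_ne volume b]
    with t ht₁ ht₂ hne hmem
  rcases hne.lt_or_gt with h | h
  · exact ht₁ ⟨hmem.1, h⟩
  · exact ht₂ ⟨h, hmem.2⟩

/-- Concatenation of solutions. -/
theorem ite_Icc (hab : a ≤ b) (hbc : b ≤ c) (h₁ : IsFilippovSolutionOn f x (Icc a b))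
    (h₂ : IsFilippovSolutionOn f y (Icc b c)) (hxy : x b = y b) :
    IsFilippovSolutionOn f (fun t => if t ≤ b then x t else y t) (Icc a c) := by
  refine union_Icc hab hbc (h₁.congr_Icc hab fun t ht => (if_pos ht.2).symm)
    (h₂.congr_Icc hbc fun t ht => ?_)
  rcases eq_or_lt_of_le ht.1 with rfl | h
  · simp [hxy]
  · simp [h.not_ge]

/-- Being a solution on an interval that is exhausted by countably many compact intervals with the
same left endpoint can be checked on these intervals. -/
theorem of_exhaustion {J : Set ℝ} {t : ℕ → ℝ}
    (hJ : ∀ u ∈ J, a ≤ u ∧ ∃ n, u ≤ t n)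
    (h : ∀ n, a ≤ t n → IsFilippovSolutionOn f x (Icc a (t n))) : IsFilippovSolutionOn f x J := by
  have h' : ∀ n, IsFilippovSolutionOn f x (Icc a (t n)) := fun n => by
    rcases le_or_gt a (t n) with hn | hn
    · exact h n hn
    · rw [Icc_eq_empty hn.not_ge]
      exact ⟨fun c d hcd hsub => absurd (hsub (left_mem_Icc.2 hcd)) (notMem_empty c), by simp⟩
  constructor
  · intro c d hcd hsub
    obtain ⟨n, hn⟩ := (hJ d (hsub (right_mem_Icc.2 hcd))).2
    exact (h' n).1 c d hcd (Icc_subset_Icc (hJ c (hsub (left_mem_Icc.2 hcd))).1 hn)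
  · have hsub : J ⊆ ⋃ n, Icc a (t n) := fun u hu => by
      obtain ⟨h₁, n, hn⟩ := hJ u hu
      exact mem_iUnion.2 ⟨n, h₁, hn⟩
    refine ae_restrict_of_ae_restrict_of_subset hsub ?_
    exact (ae_restrict_iUnion_iff _ _).2 fun n => (h' n).2

theorem Ici_of_forall_Icc (h : ∀ b, a ≤ b → IsFilippovSolutionOn f x (Icc a b)) :
    IsFilippovSolutionOn f x (Ici a) :=
  of_exhaustion (t := fun n => n) (fun u hu => ⟨hu, exists_nat_ge u⟩) fun n hn => h n hn

theorem ite_Ici (hab : a ≤ b) (h₁ : IsFilippovSolutionOn f x (Icc a b))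
    (h₂ : IsFilippovSolutionOn f y (Ici b)) (hxy : x b = y b) :
    IsFilippovSolutionOn f (fun t => if t ≤ b then x t else y t) (Ici a) := by
  refine Ici_of_forall_Icc fun c hac => ?_
  rcases le_total b c with hbc | hcb
  · exact ite_Icc hab hbc h₁ (h₂.mono Icc_subset_Ici_self) hxy
  · exact (h₁.mono (Icc_subset_Icc_right hcb)).congr_Icc hac fun t ht =>
      (if_pos (ht.2.trans hcb)).symm

end IsFilippovSolutionOn

/-! ### Solutions of the closed loop from scalar equations -/

section Scalar

variable {γ D : ℝ} {d : ℝ → ℝ} {x : ℝ → Plane} {a b : ℝ}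

/-- Reversing the state and the disturbance reverses the field. -/
theorem closedLoop_neg (t : ℝ) (y : Plane) :
    closedLoop γ (fun t => -d t) t (-y) = -closedLoop γ d t y := by
  simp only [closedLoop, feedbackLaw_neg]
  ext i
  fin_cases i <;> simp
  ring

theorem IsAdmissibleDisturbance.neg (hd : IsAdmissibleDisturbance D d) :
    IsAdmissibleDisturbance D fun t => -d t :=
  ⟨hd.1.neg, by simpa only [abs_neg] using hd.2⟩

theorem neg_mem_filippovSet_closedLoop {t : ℝ} {y v : Plane}
    (hv : v ∈ filippovSet (closedLoop γ d t) y) :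
    -v ∈ filippovSet (closedLoop γ (fun t => -d t) t) (-y) := by
  simp only [filippovSet, mem_iInter] at hv ⊢
  intro r hr N hN
  have hN' : (volume : Measure Plane) (-N) = 0 := by rwa [Measure.measure_neg]
  have hsub := closedConvexHull_min (𝕜 := ℝ)
    (s := closedLoop γ d t '' (Metric.ball y r \ -N))
    (t := {w | -w ∈ closedConvexHull ℝ
      (closedLoop γ (fun t => -d t) t '' (Metric.ball (-y) r \ N))}) ?_ ?_ ?_
  · exact hsub (hv r hr (-N) hN')
  · rintro _ ⟨z, hz, rfl⟩
    refine subset_closedConvexHull ⟨-z, ⟨?_, fun h => hz.2 (by simpa using h)⟩, closedLoop_neg t z⟩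
    simpa [dist_neg_neg] using hz.1
  · exact convex_closedConvexHull.linear_preimage (-LinearMap.id)
  · exact isClosed_closedConvexHull.preimage continuous_neg

theorem IsFilippovSolutionOn.closedLoop_neg {J : Set ℝ}
    (h : IsFilippovSolutionOn (closedLoop γ fun t => -d t) x J) :
    IsFilippovSolutionOn (closedLoop γ d) (fun t => -x t) J := by
  refine ⟨fun a b hab hsub => (h.1 a b hab hsub).fun_neg, h.2.mono fun t => ?_⟩
  rintro ⟨v, hv, hd⟩
  refine ⟨-v, ?_, hd.fun_neg⟩
  simpa using neg_mem_filippovSet_closedLoop hv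

theorem isFilippovSolutionOn_zero (hd : IsAdmissibleDisturbance D d) (hm : 0 < γ - D)
    (ha : 0 ≤ a) : IsFilippovSolutionOn (closedLoop γ d) (fun _ => 0) (Ici a) := by
  refine ⟨fun b c _ _ => (LipschitzWith.const 0).lipschitzOnWith.absolutelyContinuousOnInterval, ?_⟩
  filter_upwards [ae_restrict_of_ae_restrict_of_subset (Ici_subset_Ici.2 ha) hd.2] with t ht
  exact ⟨0, zero_mem_filippovSet_closedLoop (by linarith), hasDerivAt_const t 0⟩

theorem AbsolutelyContinuousOnInterval.euclidean_mk {X Y : ℝ → ℝ}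
    (hX : AbsolutelyContinuousOnInterval X a b) (hY : AbsolutelyContinuousOnInterval Y a b) :
    AbsolutelyContinuousOnInterval (fun t => (!₂[X t, Y t] : Plane)) a b := by
  have hc : ∀ w : Plane, AbsolutelyContinuousOnInterval (fun _ : ℝ => w) a b := fun w =>
    (LipschitzWith.const w).lipschitzOnWith.absolutelyContinuousOnInterval
  refine ((hX.fun_smul (hc !₂[1, 0])).fun_add (hY.fun_smul (hc !₂[0, 1]))).congr fun t _ => ?_
  ext i
  fin_cases i <;> simp

/-- Scalar form of the closed loop in the right half-plane. The threshold `ρ` in the denominator is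
inactive while `ρ ≤ X` or while the damping vanishes. -/
theorem isFilippovSolutionOn_of_scalar {X Y : ℝ → ℝ} {ρ : ℝ} (hab : a ≤ b)
    (hX : AbsolutelyContinuousOnInterval X a b) (hY : AbsolutelyContinuousOnInterval Y a b)
    (hderiv : ∀ᵐ t, t ∈ Ioo a b → HasDerivAt X (Y t) t ∧
      HasDerivAt Y (-γ + d t + min (Y t) 0 ^ 2 / max (X t) ρ) t)
    (hpos : ∀ t ∈ Ioo a b, 0 < X t ∧ (ρ ≤ X t ∨ 0 ≤ Y t)) :
    IsFilippovSolutionOn (closedLoop γ d) (fun t => !₂[X t, Y t]) (Icc a b) := by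
  have hfun : (fun t => !₂[X t, Y t]) =
      fun t => X t • (!₂[1, 0] : Plane) + Y t • (!₂[0, 1] : Plane) := by
    funext t; ext i; fin_cases i <;> simp
  rw [IsFilippovSolutionOn.Icc_iff hab]
  refine ⟨hX.euclidean_mk hY, ?_⟩
  filter_upwards [hderiv] with t ht hmem
  obtain ⟨h₁, h₂⟩ := ht hmem
  obtain ⟨hp, hor⟩ := hpos t hmem
  have hp' : 0 < (!₂[X t, Y t] : Plane) 0 := by simpa using hp
  refine ⟨_, mem_filippovSet_of_continuousAt (continuousAt_closedLoop hp'.ne'), ?_⟩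
  rw [hfun]
  refine ((h₁.smul_const _).fun_add (h₂.smul_const _)).congr_deriv ?_
  have hdamp : min (Y t) 0 ^ 2 / max (X t) ρ = min (Y t) 0 ^ 2 / X t := by
    rcases hor with h | h
    · rw [max_eq_left h]
    · simp [min_eq_right h]
  rw [closedLoop, feedbackLaw_of_pos hp', hdamp]
  ext i
  fin_cases i
  · simp
  · simp; ring

end Scalar

/-! ### A regularized equation with measurable forcing -/

/-- The closed loop without the measurable forcing, with the velocity truncated to `[-L', L']` in
the kinematic equation and to `[-L, 0]` in the damping, and with the denominator bounded below by
`ρ`: a bounded, globally Lipschitz field. -/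
noncomputable def truncatedField (ρ L L' : ℝ) (z : ℝ × ℝ) : ℝ × ℝ :=
  (max (-L') (min z.2 L'), max (-L) (min z.2 0) ^ 2 / max z.1 ρ)

theorem abs_truncatedField_fst_le {ρ L L' : ℝ} (hL' : 0 ≤ L') (z : ℝ × ℝ) :
    |(truncatedField ρ L L' z).1| ≤ L' := by
  rw [abs_le]
  exact ⟨le_max_left _ _, max_le (by linarith) (min_le_right _ _)⟩

theorem truncatedField_snd_mem {ρ L L' : ℝ} (hρ : 0 < ρ) (hL : 0 ≤ L) (z : ℝ × ℝ) :
    (truncatedField ρ L L' z).2 ∈ Icc 0 (L ^ 2 / ρ) := by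
  have h₁ : max (-L) (min z.2 0) ^ 2 ≤ L ^ 2 :=
    sq_le_sq' (le_max_left _ _) (max_le (by linarith) ((min_le_right _ _).trans hL))
  have h₂ : ρ ≤ max z.1 ρ := le_max_right _ _
  have h₃ : 0 < max z.1 ρ := hρ.trans_le h₂
  exact ⟨by unfold truncatedField; positivity, div_le_div₀ (sq_nonneg L) h₁ hρ h₂⟩

theorem exists_lipschitzWith_truncatedField {ρ L L' : ℝ} (hρ : 0 < ρ) (hL : 0 ≤ L) :
    ∃ K, LipschitzWith K (truncatedField ρ L L') := by
  have h₁ : LipschitzWith 1 fun z : ℝ × ℝ => max (-L') (min z.2 L') :=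
    (LipschitzWith.prod_snd.min_const L').const_max (-L')
  have hK : 0 ≤ 2 * L / ρ + L ^ 2 / ρ ^ 2 := by positivity
  have h₂ : LipschitzWith ⟨2 * L / ρ + L ^ 2 / ρ ^ 2, hK⟩
      fun z : ℝ × ℝ => max (-L) (min z.2 0) ^ 2 / max z.1 ρ := by
    refine LipschitzWith.of_dist_le_mul fun z w => ?_
    have hc : LipschitzWith 1 fun z : ℝ × ℝ => max (-L) (min z.2 0) :=
      (LipschitzWith.prod_snd.min_const 0).const_max (-L)
    have hu : LipschitzWith 1 fun z : ℝ × ℝ => max z.1 ρ := LipschitzWith.prod_fst.max_const ρ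
    have hc' := hc.dist_le_mul z w
    have hu' := hu.dist_le_mul z w
    simp only [NNReal.coe_one, one_mul, Real.dist_eq] at hc' hu' ⊢
    have hcz : |max (-L) (min z.2 0)| ≤ L :=
      abs_le.2 ⟨le_max_left _ _, max_le (by linarith) ((min_le_right _ _).trans hL)⟩
    have hcw : |max (-L) (min w.2 0)| ≤ L :=
      abs_le.2 ⟨le_max_left _ _, max_le (by linarith) ((min_le_right _ _).trans hL)⟩
    have huz : ρ ≤ max z.1 ρ := le_max_right _ _
    have huw : ρ ≤ max w.1 ρ := le_max_right _ _
    generalize max (-L) (min z.2 0) = c at *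
    generalize max (-L) (min w.2 0) = c' at *
    generalize max z.1 ρ = u at *
    generalize max w.1 ρ = u' at *
    generalize dist z w = δ at *
    have hu0 : 0 < u := hρ.trans_le huz
    have hu'0 : 0 < u' := hρ.trans_le huw
    have hsplit : c ^ 2 / u - c' ^ 2 / u' =
        (c - c') * (c + c') / u + c' ^ 2 * (u' - u) / (u * u') := by
      field_simp; ring
    have hδ : 0 ≤ δ := (abs_nonneg _).trans hc'
    have hc'2 : c' ^ 2 ≤ L ^ 2 := sq_le_sq' (abs_le.1 hcw).1 (abs_le.1 hcw).2
    have hsum : |c + c'| ≤ 2 * L := (abs_add_le _ _).trans (by linarith)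
    have hmul : ρ ^ 2 ≤ u * u' := by rw [sq]; gcongr
    have e₁ : |(c - c') * (c + c') / u| ≤ δ * (2 * L) / ρ := by
      rw [abs_div, abs_mul, abs_of_pos hu0]
      gcongr
    have e₂ : |c' ^ 2 * (u' - u) / (u * u')| ≤ L ^ 2 * δ / ρ ^ 2 := by
      rw [abs_div, abs_mul, abs_of_nonneg (sq_nonneg c'), abs_of_pos (mul_pos hu0 hu'0),
        abs_sub_comm]
      gcongr
    rw [hsplit]
    refine (abs_add_le _ _).trans ((add_le_add e₁ e₂).trans_eq ?_)
    change _ = (2 * L / ρ + L ^ 2 / ρ ^ 2) * δ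
    ring
  exact ⟨_, h₁.prodMk h₂⟩

/-- Solvability of the closed loop with a bounded measurable forcing and the denominator of the
damping bounded below. Subtracting the primitive of the forcing from the velocity leaves an
equation that is continuous in time, so the Picard–Lindelöf theorem applies; the truncation levels
are chosen such that the solution does not feel them. -/
theorem exists_scalar_solution {e : ℝ → ℝ} {s s₁ M ρ : ℝ} (hs : s ≤ s₁) (hρ : 0 < ρ) (hM : 0 ≤ M)
    (he : IntervalIntegrable e volume s s₁) (hbound : ∀ᵐ t, t ∈ Ioo s s₁ → |e t| ≤ M) (p q : ℝ) :
    ∃ X Y : ℝ → ℝ, X s = p ∧ Y s = q ∧ AbsolutelyContinuousOnInterval X s s₁ ∧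
      AbsolutelyContinuousOnInterval Y s s₁ ∧ ∀ᵐ t, t ∈ Ioo s s₁ →
        HasDerivAt X (Y t) t ∧ HasDerivAt Y (e t + min (Y t) 0 ^ 2 / max (X t) ρ) t := by
  set P : ℝ → ℝ := fun t => ∫ u in s..t, e u with hP
  have hPac : AbsolutelyContinuousOnInterval P s s₁ :=
    he.absolutelyContinuousOnInterval_intervalIntegral left_mem_uIcc
  have hPcont : ContinuousOn P (Icc s s₁) := by simpa [uIcc_of_le hs] using hPac.continuousOn
  have hPs : P s = 0 := by simp [hP]
  have hPderiv : ∀ᵐ t, t ∈ Ioo s s₁ → HasDerivAt P (e t) t := by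
    filter_upwards [he.ae_hasDerivAt_integral] with t ht hmem
    refine ht ?_ s left_mem_uIcc
    rw [uIcc_of_le hs]
    exact Ioo_subset_Icc_self hmem
  have hPbound : ∀ t ∈ Icc s s₁, |P t| ≤ M * (s₁ - s) := by
    intro t ht
    have := (hPac.mono (by rw [uIcc_of_le hs, uIcc_of_le ht.1]; exact Icc_subset_Icc_right ht.2)
      ).abs_sub_le_of_ae_deriv_le (K := M) ht.1 (by
        filter_upwards [hPderiv, hbound] with u h₁ h₂ hmem
        have hmem' : u ∈ Ioo s s₁ := ⟨hmem.1, hmem.2.trans_le ht.2⟩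
        exact ⟨e u, h₂ hmem', h₁ hmem'⟩)
    rw [hPs, sub_zero] at this
    have h₂ := ht.2
    exact this.trans (by gcongr)
  have hA : 0 ≤ s₁ - s := sub_nonneg.2 hs
  -- the level `L₂` bounds negative velocities, and `L` bounds all velocities
  set L₂ := |q| + M * (s₁ - s) with hL₂
  set L := L₂ + L₂ ^ 2 / ρ * (s₁ - s) with hL
  have hL₂0 : 0 ≤ L₂ := by positivity
  have hL₂L : L₂ ≤ L := by rw [hL]; linarith [show 0 ≤ L₂ ^ 2 / ρ * (s₁ - s) by positivity]
  have hL0 : 0 ≤ L := hL₂0.trans hL₂L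
  obtain ⟨K, hK⟩ := exists_lipschitzWith_truncatedField (L' := L) hρ hL₂0
  set G := truncatedField ρ L₂ L
  have hG₁ : ∀ z, |(G z).1| ≤ L := abs_truncatedField_fst_le hL0
  have hG₂ : ∀ z, (G z).2 ∈ Icc 0 (L₂ ^ 2 / ρ) := truncatedField_snd_mem hρ hL₂0
  have hN0 : 0 ≤ L + L₂ ^ 2 / ρ := by positivity
  have hGnorm : ∀ z, ‖G z‖ ≤ L + L₂ ^ 2 / ρ := by
    intro z
    have h₁ := hG₂ z
    rw [Prod.norm_def, Real.norm_eq_abs, Real.norm_eq_abs, abs_of_nonneg h₁.1]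
    exact max_le ((hG₁ z).trans (by linarith [show 0 ≤ L₂ ^ 2 / ρ by positivity])) (by linarith [h₁.2])
  have hPL : IsPicardLindelof (fun t z => G (z + (0, P t))) (⟨s, left_mem_Icc.2 hs⟩ : Icc s s₁)
      (p, q) ⟨(L + L₂ ^ 2 / ρ) * (s₁ - s), by positivity⟩ 0 ⟨L + L₂ ^ 2 / ρ, hN0⟩ K := by
    refine ⟨fun t _ => ?_, fun z _ => ?_, fun t _ z _ => hGnorm _, ?_⟩
    · refine (hK.comp (g := fun z : ℝ × ℝ => z + (0, P t)) (Kg := 1) ?_).lipschitzOnWith.weaken ?_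
      · exact (isometry_add_right _).lipschitz
      · rw [mul_one]
    · exact hK.continuous.comp_continuousOn
        (continuousOn_const.add (continuousOn_const.prodMk hPcont))
    · change (L + L₂ ^ 2 / ρ) * max (s₁ - s) (s - s) ≤ (L + L₂ ^ 2 / ρ) * (s₁ - s) - 0
      rw [sub_self, max_eq_left hA, sub_zero]
  obtain ⟨α, hα0, hα⟩ := hPL.exists_eq_forall_mem_Icc_hasDerivWithinAt₀
  have hα0 : α s = (p, q) := hα0
  have hαlip : LipschitzOnWith ⟨L + L₂ ^ 2 / ρ, hN0⟩ α (uIcc s s₁) := by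
    rw [uIcc_of_le hs]
    exact (convex_Icc s s₁).lipschitzOnWith_of_nnnorm_hasDerivWithin_le hα fun t _ => hGnorm _
  have hαac := hαlip.absolutelyContinuousOnInterval
  have hXac : AbsolutelyContinuousOnInterval (fun t => (α t).1) s s₁ :=
    hαac.comp_lipschitzOnWith LipschitzWith.prod_fst.lipschitzOnWith
  have hZac : AbsolutelyContinuousOnInterval (fun t => (α t).2) s s₁ :=
    hαac.comp_lipschitzOnWith LipschitzWith.prod_snd.lipschitzOnWith
  have hd : ∀ t ∈ Ioo s s₁, HasDerivAt α (G (α t + (0, P t))) t := fun t ht =>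
    (hα t (Ioo_subset_Icc_self ht)).hasDerivAt (Icc_mem_nhds ht.1 ht.2)
  have hZ : ∀ t ∈ Icc s s₁, q ≤ (α t).2 ∧ (α t).2 ≤ q + L₂ ^ 2 / ρ * (s₁ - s) := by
    intro t ht
    have hsub : uIcc s t ⊆ uIcc s s₁ := by
      rw [uIcc_of_le hs, uIcc_of_le ht.1]; exact Icc_subset_Icc_right ht.2
    have hd' : ∀ u ∈ Ioo s t, HasDerivAt (fun u => (α u).2) (G (α u + (0, P u))).2 u := fun u hu =>
      (hd u ⟨hu.1, hu.2.trans_le ht.2⟩).snd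
    have h₁ := (hZac.mono hsub).fun_neg.le_of_ae_deriv_nonpos ht.1 (Eventually.of_forall
      fun u hu => ⟨_, neg_nonpos.2 (hG₂ _).1, (hd' u hu).fun_neg⟩)
    have h₂ := (hZac.mono hsub).abs_sub_le_of_ae_deriv_le (K := L₂ ^ 2 / ρ) ht.1
      (Eventually.of_forall fun u hu => ⟨_, by
        rw [abs_of_nonneg (hG₂ _).1]; exact (hG₂ _).2, hd' u hu⟩)
    simp only [hα0] at h₁ h₂
    have h₃ : L₂ ^ 2 / ρ * (t - s) ≤ L₂ ^ 2 / ρ * (s₁ - s) := by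
      have := ht.2
      gcongr
    constructor
    · linarith
    · linarith [(abs_le.1 h₂).2]
  refine ⟨fun t => (α t).1, fun t => (α t).2 + P t, by simp [hα0], by simp [hα0, hPs], hXac,
    hZac.fun_add hPac, ?_⟩
  filter_upwards [hPderiv] with t hPt hmem
  have hmem' := Ioo_subset_Icc_self hmem
  obtain ⟨hz₁, hz₂⟩ := hZ t hmem'
  have hp := abs_le.1 (hPbound t hmem')
  have hq := neg_abs_le q
  have hq' := le_abs_self q
  have hlow : -L₂ ≤ (α t).2 + P t := by rw [hL₂]; linarith
  have hupp : (α t).2 + P t ≤ L := by rw [hL, hL₂]; linarith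
  have hGt : G (α t + (0, P t)) =
      ((α t).2 + P t, min ((α t).2 + P t) 0 ^ 2 / max (α t).1 ρ) := by
    simp only [G, truncatedField, Prod.snd_add, Prod.fst_add, add_zero]
    rw [min_eq_left hupp, max_eq_right (by linarith), max_eq_right (le_min hlow (by linarith))]
  have hdt := hd t hmem
  rw [hGt] at hdt
  have hdt₂ : HasDerivAt (fun t => (α t).2) (min ((α t).2 + P t) 0 ^ 2 / max (α t).1 ρ) t := hdt.snd
  exact ⟨hdt.fst, (hdt₂.fun_add (hPt hmem)).congr_deriv (by ring)⟩

/-! ### Local existence -/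

section LocalExistence

variable {γ D : ℝ} {d : ℝ → ℝ} {p q s : ℝ}

theorem IsAdmissibleDisturbance.intervalIntegrable (hd : IsAdmissibleDisturbance D d) (γ : ℝ)
    {a b : ℝ} (ha : 0 ≤ a) (hab : a ≤ b) :
    IntervalIntegrable (fun t => -γ + d t) volume a b := by
  refine intervalIntegrable_const.add ?_
  rw [intervalIntegrable_iff_integrableOn_Icc_of_le hab]
  have hsub : Icc a b ⊆ Ici 0 := fun t ht => ha.trans ht.1
  refine Integrable.mono' (integrable_const D)
    (hd.1.mono_measure (Measure.restrict_mono hsub le_rfl)).aestronglyMeasurable ?_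
  exact ae_restrict_of_ae_restrict_of_subset hsub hd.2

/-- Solvability of the closed loop in which the denominator of the damping is bounded below. -/
theorem IsAdmissibleDisturbance.exists_scalar_solution (hd : IsAdmissibleDisturbance D d)
    (hγ : 0 ≤ γ + D) (hγ0 : 0 ≤ γ) {ρ s₁ : ℝ} (hs0 : 0 ≤ s) (hs : s ≤ s₁) (hρ : 0 < ρ) (p q : ℝ) :
    ∃ X Y : ℝ → ℝ, X s = p ∧ Y s = q ∧ AbsolutelyContinuousOnInterval X s s₁ ∧
      AbsolutelyContinuousOnInterval Y s s₁ ∧ ∀ᵐ t, t ∈ Ioo s s₁ →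
        HasDerivAt X (Y t) t ∧
        HasDerivAt Y (-γ + d t + min (Y t) 0 ^ 2 / max (X t) ρ) t := by
  refine _root_.exists_scalar_solution hs hρ hγ (hd.intervalIntegrable γ hs0 hs) ?_ p q
  filter_upwards [(ae_restrict_iff' measurableSet_Ici).1 hd.2] with t ht hmem
  have := abs_le.1 (ht (hs0.trans hmem.1.le))
  rw [abs_le]
  constructor <;> linarith

/-- From a point of the open right half-plane, a solution halves its first coordinate. -/
theorem exists_arc_halving (hd : IsAdmissibleDisturbance D d) (hm : 0 < γ - D) (hD : 0 ≤ D)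
    (hs : 0 ≤ s) {x₀ : Plane} (hp : 0 < x₀ 0) :
    ∃ (s₁ : ℝ) (x : ℝ → Plane), s < s₁ ∧ IsFilippovSolutionOn (closedLoop γ d) x (Icc s s₁) ∧
      x s = x₀ ∧ (∀ t ∈ Icc s s₁, 0 < x t 0) ∧ x s₁ 0 = x₀ 0 / 2 := by
  have hM : 0 < γ + D := by linarith
  have hr : 0 < ‖x₀‖ := by
    rw [norm_pos_iff]; rintro rfl; simp at hp
  obtain ⟨T, hT, hdecay⟩ := exists_attraction_time hm hM hr (half_pos hp)
  have hsT : s ≤ s + T := by linarith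
  obtain ⟨X, Y, hXs, hYs, hXac, hYac, hderiv⟩ := hd.exists_scalar_solution hM.le (by linarith) hs hsT
    (half_pos hp) (x₀ 0) (x₀ 1)
  have hxs : (!₂[X s, Y s] : Plane) = x₀ := by
    ext i; fin_cases i <;> simp [hXs, hYs]
  have hXc : ContinuousOn X (Icc s (s + T)) := by simpa [uIcc_of_le hsT] using hXac.continuousOn
  have hsol : ∀ s₁ ∈ Icc s (s + T), (∀ t ∈ Ioo s s₁, x₀ 0 / 2 < X t) →
      IsFilippovSolutionOn (closedLoop γ d) (fun t => !₂[X t, Y t]) (Icc s s₁) := by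
    intro s₁ hs₁ hlt
    have hsub : uIcc s s₁ ⊆ uIcc s (s + T) := by
      rw [uIcc_of_le hs₁.1, uIcc_of_le hsT]; exact Icc_subset_Icc_right hs₁.2
    refine isFilippovSolutionOn_of_scalar (ρ := x₀ 0 / 2) hs₁.1 (hXac.mono hsub) (hYac.mono hsub)
      ?_ fun t ht => ⟨(half_pos hp).trans (hlt t ht), .inl (hlt t ht).le⟩
    filter_upwards [hderiv] with t h hmem using h ⟨hmem.1, hmem.2.trans_le hs₁.2⟩
  -- the first time `s₁` at which the first coordinate is at most `x₀ 0 / 2`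
  have hne : {t ∈ Icc s (s + T) | X t ≤ x₀ 0 / 2}.Nonempty := by
    by_contra! hempty
    have hlt : ∀ t ∈ Icc s (s + T), x₀ 0 / 2 < X t := fun t ht => by
      by_contra! hle
      exact (hempty ▸ (⟨ht, hle⟩ : t ∈ {t ∈ Icc s (s + T) | X t ≤ x₀ 0 / 2}) : t ∈ (∅ : Set ℝ))
    have h₁ := hsol (s + T) ⟨hsT, le_rfl⟩ fun t ht => hlt t (Ioo_subset_Icc_self ht)
    have h₂ := hdecay _ s (s + T) (h₁.isInclusionArc hd measurableSet_Icc hs hsT le_rfl)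
      (by rw [hxs]) le_rfl
    have h₃ := (PiLp.norm_apply_le (!₂[X (s + T), Y (s + T)] : Plane) 0).trans_lt h₂
    have h₄ := hlt (s + T) ⟨hsT, le_rfl⟩
    have h₅ : |X (s + T)| < x₀ 0 / 2 := by simpa using h₃
    exact absurd ((le_abs_self _).trans_lt h₅) h₄.not_gt
  have hcl : IsClosed {t ∈ Icc s (s + T) | X t ≤ x₀ 0 / 2} :=
    hXc.preimage_isClosed_of_isClosed isClosed_Icc isClosed_Iic
  have hbd : BddBelow {t ∈ Icc s (s + T) | X t ≤ x₀ 0 / 2} := ⟨s, fun t ht => ht.1.1⟩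
  have hmem := hcl.csInf_mem hne hbd
  set s₁ := sInf {t ∈ Icc s (s + T) | X t ≤ x₀ 0 / 2}
  have hlt : ∀ t ∈ Ico s s₁, x₀ 0 / 2 < X t := fun t ht => by
    by_contra! hle
    exact ht.2.not_ge (csInf_le hbd ⟨⟨ht.1, ht.2.le.trans hmem.1.2⟩, hle⟩)
  have hss₁ : s < s₁ := by
    refine hmem.1.1.lt_of_ne fun h => ?_
    have := hmem.2
    rw [← h, hXs] at this
    linarith
  have hXs₁ : X s₁ = x₀ 0 / 2 := by
    obtain ⟨u, hu, hXu⟩ := intermediate_value_Icc' hss₁.le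
      (hXc.mono (Icc_subset_Icc_right hmem.1.2)) ⟨hmem.2, by rw [hXs]; linarith⟩
    rcases eq_or_lt_of_le hu.2 with h | h
    · rw [← h, hXu]
    · exact absurd hXu (hlt u ⟨hu.1, h⟩).ne'
  refine ⟨s₁, _, hss₁, hsol s₁ hmem.1 fun t ht => hlt t (Ioo_subset_Ico_self ht), hxs,
    fun t ht => ?_, by simpa using hXs₁⟩
  simp only [Matrix.cons_val_zero]
  rcases eq_or_lt_of_le ht.2 with h | h
  · rw [h, hXs₁]; exact half_pos hp
  · exact (half_pos hp).trans (hlt t ⟨ht.1, h⟩)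

/-- From a point of the positive vertical axis, a solution enters the right half-plane. -/
theorem exists_arc_of_axis (hd : IsAdmissibleDisturbance D d) (hm : 0 < γ - D) (hD : 0 ≤ D)
    (hs : 0 ≤ s) {x₀ : Plane} (hp : x₀ 0 = 0) (hq : 0 < x₀ 1) :
    ∃ (s₁ : ℝ) (x : ℝ → Plane), s < s₁ ∧ IsFilippovSolutionOn (closedLoop γ d) x (Icc s s₁) ∧
      x s = x₀ ∧ 0 < x s₁ 0 := by
  have hM : 0 < γ + D := by linarith
  set A := x₀ 1 / (2 * (γ + D)) with hA
  have hA0 : 0 < A := by positivity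
  have hsA : s ≤ s + A := by linarith
  obtain ⟨X, Y, hXs, hYs, hXac, hYac, hderiv⟩ := hd.exists_scalar_solution hM.le (by linarith) hs hsA
    one_pos (x₀ 0) (x₀ 1)
  have hxs : (!₂[X s, Y s] : Plane) = x₀ := by
    ext i; fin_cases i <;> simp [hXs, hYs]
  have hsub : ∀ t ∈ Icc s (s + A), uIcc s t ⊆ uIcc s (s + A) := fun t ht => by
    rw [uIcc_of_le ht.1, uIcc_of_le hsA]; exact Icc_subset_Icc_right ht.2
  -- the velocity cannot lose more than half of its initial value
  have hY : ∀ t ∈ Icc s (s + A), x₀ 1 / 2 ≤ Y t := by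
    intro t ht
    have hac : AbsolutelyContinuousOnInterval (fun u => -(γ + D) * u - Y u) s t :=
      (AbsolutelyContinuousOnInterval.of_contDiff (by fun_prop) s t).fun_sub
        (hYac.mono (hsub t ht))
    have := hac.le_of_ae_deriv_nonpos ht.1 (by
      filter_upwards [hderiv, (ae_restrict_iff' measurableSet_Ici).1 hd.2] with u h₁ h₂ hmem
      refine ⟨_, ?_, ((hasDerivAt_id u).const_mul (-(γ + D))).fun_sub
        (h₁ ⟨hmem.1, hmem.2.trans_le ht.2⟩).2⟩
      have h₃ := abs_le.1 (h₂ (hs.trans hmem.1.le))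
      have h₄ : 0 < max (X u) 1 := one_pos.trans_le (le_max_right _ _)
      have h₅ : 0 ≤ min (Y u) 0 ^ 2 / max (X u) 1 := by positivity
      linarith)
    have h₂ : (γ + D) * (t - s) ≤ x₀ 1 / 2 := by
      calc (γ + D) * (t - s) ≤ (γ + D) * A := by gcongr; linarith [ht.2]
        _ = x₀ 1 / 2 := by rw [hA]; field_simp
    rw [hYs] at this
    linarith
  have hX : ∀ t ∈ Icc s (s + A), x₀ 1 / 2 * (t - s) ≤ X t := by
    intro t ht
    have hac : AbsolutelyContinuousOnInterval (fun u => x₀ 1 / 2 * u - X u) s t :=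
      (AbsolutelyContinuousOnInterval.of_contDiff (by fun_prop) s t).fun_sub
        (hXac.mono (hsub t ht))
    have := hac.le_of_ae_deriv_nonpos ht.1 (by
      filter_upwards [hderiv] with u h₁ hmem
      have hmem' : u ∈ Ioo s (s + A) := ⟨hmem.1, hmem.2.trans_le ht.2⟩
      refine ⟨_, ?_, ((hasDerivAt_id u).const_mul (x₀ 1 / 2)).fun_sub (h₁ hmem').1⟩
      have := hY u (Ioo_subset_Icc_self hmem')
      linarith)
    rw [hXs, hp] at this
    linarith
  refine ⟨s + A, _, by linarith, isFilippovSolutionOn_of_scalar (ρ := 1) hsA hXac hYac hderiv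
    fun t ht => ⟨?_, .inr ?_⟩, hxs, ?_⟩
  · have h₁ := hX t (Ioo_subset_Icc_self ht)
    have h₂ : 0 < x₀ 1 / 2 * (t - s) := mul_pos (half_pos hq) (by linarith [ht.1])
    linarith
  · linarith [hY t (Ioo_subset_Icc_self ht)]
  · have h₁ := hX (s + A) ⟨hsA, le_rfl⟩
    have h₂ : 0 < x₀ 1 / 2 * (s + A - s) := mul_pos (half_pos hq) (by linarith)
    simp only [Matrix.cons_val_zero]
    linarith

end LocalExistence

/-! ### Global existence and forward completeness -/

section GlobalExistence

variable {γ D : ℝ} {d : ℝ → ℝ} {x : ℝ → Plane} {x₀ : Plane} {a s T : ℝ}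

/-- Away from its initial time, an arc in the right half-plane is Lipschitz up to the (excluded) end
of its interval: it stays below a parabola `(x 1)² = C (x 0)`, hence the damping is bounded. -/
theorem exists_lipschitz_of_pos (hm : 0 < γ - D) (hM : 0 ≤ γ + D) {c : ℝ} (hac : a < c)
    (hx : ∀ u ∈ Ioo c T, IsInclusionArc γ D x a u) (hpos : ∀ u ∈ Ioo a T, 0 < x u 0) :
    ∃ K, ∀ u ∈ Ioo c T, ∀ t ∈ Icc c u, ∀ i : Fin 2, |x u i - x t i| ≤ K * (u - t) := by
  rcases le_or_gt T c with hTc | hcT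
  · exact ⟨0, fun u hu => absurd (hu.1.trans hu.2) hTc.not_gt⟩
  set r := ‖x a‖
  set B := r + r ^ 2 / (2 * (γ - D))
  set C := max (2 * (γ + D)) (x c 1 ^ 2 / x c 0) with hC
  have hC0 : 0 ≤ C := le_max_of_le_left (by linarith)
  have hB0 : 0 ≤ B := by positivity
  have hxc : 0 < x c 0 := hpos c ⟨hac, hcT⟩
  refine ⟨(C * B + 1) + (γ + D + C), fun u hu t ht i => ?_⟩
  have harc := hx u hu
  have hr := (harc.mono hac.le hu.1.le le_rfl).isRightArc
    fun t ht => hpos t ⟨hac.trans ht.1, ht.2.trans hu.2⟩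
  have hpar : ∀ t ∈ Icc c u, x t 1 ^ 2 ≤ C * x t 0 := by
    intro t ht
    have := (hr.mono le_rfl ht.1 ht.2).sq_sub_le hm ht.1 (le_max_left _ (x c 1 ^ 2 / x c 0))
    rw [max_eq_right (a := x c 1 ^ 2 - _)] at this
    · linarith
    · rw [sub_nonpos, ← div_le_iff₀ hxc]
      exact le_max_right _ _
  have hpos' : ∀ t ∈ Icc c u, 0 < x t 0 := fun t ht =>
    hpos t ⟨hac.trans_le ht.1, ht.2.trans_lt hu.2⟩
  have hder : ∀ᵐ t, t ∈ Ioo c u → ∀ i : Fin 2, ∃ v, |v| ≤ (C * B + 1) + (γ + D + C) ∧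
      HasDerivAt (fun t => x t i) v t := by
    filter_upwards [hr.deriv] with t h hmem
    have hmem' := Ioo_subset_Icc_self hmem
    obtain ⟨h₁, g, hg, h₂⟩ := h hmem
    have hCB : 0 ≤ C * B := by positivity
    intro i
    fin_cases i
    · refine ⟨_, ?_, h₁⟩
      have hb := (harc.mono le_rfl (hac.le.trans hmem'.1) hmem'.2).abs_position_le hm hM
        (hac.le.trans hmem'.1) le_rfl
      have hsq : x t 1 ^ 2 ≤ C * B :=
        (hpar t hmem').trans (by gcongr; exact (le_abs_self _).trans hb)
      have : |x t 1| ≤ C * B + 1 := by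
        rw [abs_le]; constructor <;> nlinarith
      linarith
    · refine ⟨_, ?_, h₂⟩
      have hx0 := hpos' t hmem'
      have hdamp : min (x t 1) 0 ^ 2 / x t 0 ≤ C := by
        rw [div_le_iff₀ hx0]
        refine le_trans ?_ (hpar t hmem')
        rcases le_total (x t 1) 0 with h | h
        · rw [min_eq_left h]
        · rw [min_eq_right h]; nlinarith
      have hdamp0 : 0 ≤ min (x t 1) 0 ^ 2 / x t 0 := by positivity
      have := hg.1
      have := hg.2
      rw [abs_le]
      constructor <;> linarith
  refine ((harc.ac.euclidean_apply i).mono ?_).abs_sub_le_of_ae_deriv_le ht.2 ?_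
  · rw [uIcc_of_le ht.2, uIcc_of_le (hac.le.trans hu.1.le)]
    exact Icc_subset_Icc_left (hac.le.trans ht.1)
  · filter_upwards [hder] with v h hmem using h ⟨ht.1.trans_lt hmem.1, hmem.2⟩ i

/-- A solution on a half-open interval that avoids the line `x 0 = 0` extends to the closed
interval. -/
theorem IsFilippovSolutionOn.exists_extension_Icc (hd : IsAdmissibleDisturbance D d)
    (hm : 0 < γ - D) (hM : 0 ≤ γ + D) (ha : 0 ≤ a) (haT : a < T)
    (hx : IsFilippovSolutionOn (closedLoop γ d) x (Ico a T)) (hne : ∀ t ∈ Ioo a T, x t 0 ≠ 0) :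
    ∃ y, IsFilippovSolutionOn (closedLoop γ d) y (Icc a T) ∧ EqOn x y (Ico a T) := by
  set c := (a + T) / 2 with hc
  have hac : a < c := by linarith
  have hcT : c < T := by linarith
  have harc : ∀ u ∈ Ico a T, IsInclusionArc γ D x a u := fun u hu =>
    hx.isInclusionArc hd measurableSet_Ico ha hu.1 (Icc_subset_Ico_right hu.2)
  have harc' : ∀ u ∈ Ioo c T, IsInclusionArc γ D x a u := fun u hu =>
    harc u ⟨hac.le.trans hu.1.le, hu.2⟩
  obtain ⟨K, hK⟩ : ∃ K, ∀ u ∈ Ioo c T, ∀ t ∈ Icc c u, ∀ i : Fin 2,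
      |x u i - x t i| ≤ K * (u - t) := by
    have hsign : (∀ u ∈ Ioo a T, 0 < x u 0) ∨ (∀ u ∈ Ioo a T, x u 0 < 0) := by
      by_contra! hcon
      obtain ⟨⟨u, hu, hu0⟩, ⟨v, hv, hv0⟩⟩ := hcon
      obtain ⟨w, hw, hwT⟩ := exists_between (max_lt hu.2 hv.2)
      have hw := max_lt_iff.1 hw
      rcases (harc w ⟨hu.1.le.trans hw.1.le, hwT⟩).pos_or_neg (hu.1.le.trans hw.1.le)
        (fun t ht => hne t ⟨ht.1, ht.2.trans hwT⟩) with h | h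
      · exact hu0.not_gt (h u ⟨hu.1, hw.1⟩)
      · exact hv0.not_gt (h v ⟨hv.1, hw.2⟩)
    rcases hsign with h | h
    · exact exists_lipschitz_of_pos hm hM hac harc' h
    · obtain ⟨K, hK⟩ := exists_lipschitz_of_pos hm hM hac (fun u hu => (harc' u hu).neg)
        (fun u hu => by simpa using h u hu)
      refine ⟨K, fun u hu t ht i => ?_⟩
      have := hK u hu t ht i
      rwa [PiLp.neg_apply, PiLp.neg_apply, neg_sub_neg, abs_sub_comm] at this
  have hlip : ∀ i : Fin 2, LipschitzOnWith (Real.toNNReal K) (fun t => x t i) (Ico c T) := by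
    intro i
    refine LipschitzOnWith.of_le_add_mul' K fun u hu t ht => ?_
    rw [Real.dist_eq]
    rcases eq_or_lt_of_le hu.1 with rfl | hu'
    · rcases eq_or_lt_of_le ht.1 with rfl | ht'
      · simp
      · have := hK t ⟨ht', ht.2⟩ c ⟨le_rfl, ht.1⟩ i
        rw [abs_sub_comm c t, abs_of_nonneg (sub_nonneg.2 ht.1)]
        linarith [(abs_le.1 this).1]
    · rcases le_total t u with h | h
      · have := hK u ⟨hu', hu.2⟩ t ⟨ht.1, h⟩ i
        rw [abs_of_nonneg (sub_nonneg.2 h)]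
        linarith [(abs_le.1 this).2]
      · have := hK t ⟨hu'.trans_le h, ht.2⟩ u ⟨hu.1, h⟩ i
        rw [abs_sub_comm u t, abs_of_nonneg (sub_nonneg.2 h)]
        linarith [(abs_le.1 this).1]
  obtain ⟨Z₀, hZ₀, hxZ₀⟩ := (hlip 0).extend_real
  obtain ⟨Z₁, hZ₁, hxZ₁⟩ := (hlip 1).extend_real
  have hEq : EqOn x (fun t => if t < T then x t else !₂[Z₀ T, Z₁ T]) (Ico a T) :=
    fun t ht => (if_pos ht.2).symm
  refine ⟨_, (IsFilippovSolutionOn.Icc_iff haT.le).2 ⟨?_, ?_⟩, hEq⟩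
  · refine .trans hac.le hcT.le ((harc c ⟨hac.le, hcT⟩).ac.congr ?_)
      ((hZ₀.lipschitzOnWith.absolutelyContinuousOnInterval.euclidean_mk
        hZ₁.lipschitzOnWith.absolutelyContinuousOnInterval).congr ?_)
    · rw [uIcc_of_le hac.le]
      exact hEq.mono (Icc_subset_Ico_right hcT)
    · rw [uIcc_of_le hcT.le]
      intro t ht
      rcases eq_or_lt_of_le ht.2 with rfl | h
      · simp
      · simp only [h, if_true]
        ext i
        fin_cases i
        · exact (hxZ₀ ⟨ht.1, h⟩).symm
        · exact (hxZ₁ ⟨ht.1, h⟩).symm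
  · filter_upwards [(ae_restrict_iff' measurableSet_Ico).1 hx.2] with t ht hmem
    obtain ⟨v, hv, hderiv⟩ := ht (Ioo_subset_Ico_self hmem)
    rw [if_pos hmem.2]
    refine ⟨v, hv, hderiv.congr_of_eventuallyEq ?_⟩
    filter_upwards [isOpen_Ioo.mem_nhds hmem] with u hu
    exact (hEq (Ioo_subset_Ico_self hu)).symm

/-- Iterated halving of the first coordinate: a solution on the union of the intervals `[s, τ n]`,
along which the first coordinate is positive and equals `x₀ 0 / 2 ^ n` at `τ n`. -/
theorem exists_halving_solution (hd : IsAdmissibleDisturbance D d) (hm : 0 < γ - D) (hD : 0 ≤ D)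
    (hs : 0 ≤ s) (hp : 0 < x₀ 0) :
    ∃ (τ : ℕ → ℝ) (x : ℝ → Plane), StrictMono τ ∧ τ 0 = s ∧ x s = x₀ ∧
      ∀ n, IsFilippovSolutionOn (closedLoop γ d) x (Icc s (τ n)) ∧
        (∀ t ∈ Icc s (τ n), 0 < x t 0) ∧ x (τ n) 0 = x₀ 0 / 2 ^ n := by
  -- positive solutions on compact intervals `[s, P.1]`, extended step by step
  let S := {P : ℝ × (ℝ → Plane) // s ≤ P.1 ∧
    IsFilippovSolutionOn (closedLoop γ d) P.2 (Icc s P.1) ∧ ∀ t ∈ Icc s P.1, 0 < P.2 t 0}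
  have hstep : ∀ P : S, ∃ Q : S, P.1.1 < Q.1.1 ∧ EqOn P.1.2 Q.1.2 (Icc s P.1.1) ∧
      Q.1.2 Q.1.1 0 = P.1.2 P.1.1 0 / 2 := by
    rintro ⟨⟨t, x⟩, hst, hx, hpos⟩
    obtain ⟨t', y, htt', hy, hyt, hypos, hyhalf⟩ :=
      exists_arc_halving hd hm hD (hs.trans hst) (hpos t ⟨hst, le_rfl⟩)
    refine ⟨⟨(t', fun u => if u ≤ t then x u else y u), hst.trans htt'.le,
      hx.ite_Icc hst htt'.le hy hyt.symm, fun u hu => ?_⟩, htt',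
      fun u hu => (if_pos hu.2).symm, ?_⟩
    · by_cases h : u ≤ t
      · simpa [h] using hpos u ⟨hu.1, h⟩
      · simpa [h] using hypos u ⟨(not_le.1 h).le, hu.2⟩
    · simpa [htt'.not_ge] using hyhalf
  choose next hlt heq hhalf using hstep
  let P₀ : S := ⟨(s, fun _ => x₀), le_rfl, by
    rw [IsFilippovSolutionOn.Icc_iff le_rfl]
    exact ⟨(LipschitzWith.const x₀).lipschitzOnWith.absolutelyContinuousOnInterval, by simp⟩,
    fun t _ => hp⟩
  let P : ℕ → S := fun n => next^[n] P₀
  have hsucc : ∀ n, P (n + 1) = next (P n) := fun n => Function.iterate_succ_apply' next n P₀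
  have hmono : StrictMono fun n => (P n).1.1 := strictMono_nat_of_lt_succ fun n => by
    rw [hsucc]; exact hlt _
  have hcons : ∀ m n, m ≤ n → EqOn (P m).1.2 (P n).1.2 (Icc s (P m).1.1) := by
    intro m n hmn
    induction n, hmn using Nat.le_induction with
    | base => exact fun _ _ => rfl
    | succ n hmn ih =>
      refine ih.trans ?_
      rw [hsucc]
      exact (heq (P n)).mono (Icc_subset_Icc_right (hmono.monotone hmn))
  have hval : ∀ n, (P n).1.2 (P n).1.1 0 = x₀ 0 / 2 ^ n := by
    intro n
    induction n with
    | zero => simp [P, P₀]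
    | succ n ih => rw [hsucc, hhalf, ih, pow_succ, div_div]
  classical
  let x : ℝ → Plane := fun t => if h : ∃ n, t ≤ (P n).1.1 then (P (Nat.find h)).1.2 t else 0
  have hx : ∀ n, EqOn (P n).1.2 x (Icc s (P n).1.1) := by
    intro n t ht
    have h : ∃ n, t ≤ (P n).1.1 := ⟨n, ht.2⟩
    simp only [x, dif_pos h]
    exact (hcons _ n (Nat.find_min' h ht.2) ⟨ht.1, Nat.find_spec h⟩).symm
  refine ⟨fun n => (P n).1.1, x, hmono, rfl, (hx 0 ⟨le_rfl, le_rfl⟩).symm, fun n => ⟨?_, ?_, ?_⟩⟩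
  · exact (P n).2.2.1.congr_Icc (P n).2.1 (hx n)
  · intro t ht
    rw [← hx n ht]
    exact (P n).2.2.2 t ht
  · rw [← hx n ⟨(P n).2.1, le_rfl⟩, hval]

/-- Global existence from the open right half-plane. -/
theorem exists_solution_of_pos (hd : IsAdmissibleDisturbance D d) (hm : 0 < γ - D) (hD : 0 ≤ D)
    (hs : 0 ≤ s) (hp : 0 < x₀ 0) :
    ∃ x, IsFilippovSolutionOn (closedLoop γ d) x (Ici s) ∧ x s = x₀ := by
  obtain ⟨τ, x, hτ, hτ0, hxs, hx⟩ := exists_halving_solution hd hm hD hs hp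
  have hsτ : ∀ n, s ≤ τ n := fun n => hτ0 ▸ hτ.monotone (Nat.zero_le n)
  by_cases hbdd : BddAbove (range τ)
  · -- the halving times accumulate at `T`, where the solution reaches the origin
    set T := ⨆ n, τ n with hT
    have hle : ∀ n, τ n < T := fun n => (hτ (Nat.lt_succ_self n)).trans_le (le_ciSup hbdd (n + 1))
    have hsT : s < T := (hsτ 0).trans_lt (hle 0)
    have hlim : Tendsto τ atTop (nhds T) := tendsto_atTop_ciSup hτ.monotone hbdd
    have hxT : IsFilippovSolutionOn (closedLoop γ d) x (Ico s T) := by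
      refine .of_exhaustion (t := τ) (fun u hu => ⟨hu.1, ?_⟩) fun n _ => (hx n).1
      obtain ⟨n, hn⟩ := exists_lt_of_lt_ciSup hu.2
      exact ⟨n, hn.le⟩
    obtain ⟨y, hy, hxy⟩ := hxT.exists_extension_Icc hd hm (by linarith) hs hsT fun t ht => by
      obtain ⟨n, hn⟩ := exists_lt_of_lt_ciSup ht.2
      exact ((hx n).2.1 t ⟨ht.1.le, hn.le⟩).ne'
    have harc := hy.isInclusionArc hd measurableSet_Icc hs hsT.le le_rfl
    have hyT0 : y T 0 = 0 := by
      have h₁ : Tendsto (fun n => y (τ n) 0) atTop (nhds (y T 0)) :=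
        (harc.continuousOn_apply hsT.le 0 T (right_mem_Icc.2 hsT.le)).tendsto.comp
          (tendsto_nhdsWithin_iff.2 ⟨hlim, Eventually.of_forall fun n => ⟨hsτ n, (hle n).le⟩⟩)
      have h₂ : Tendsto (fun n => y (τ n) 0) atTop (nhds 0) := by
        have h₃ : (fun n => y (τ n) 0) = fun n => x₀ 0 * (1 / 2) ^ n := by
          funext n
          rw [← hxy ⟨hsτ n, hle n⟩, (hx n).2.2, one_div_pow]
          ring
        rw [h₃, ← mul_zero (x₀ 0)]
        exact (tendsto_pow_atTop_nhds_zero_of_lt_one (by norm_num) (by norm_num)).const_mul _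
      exact tendsto_nhds_unique h₁ h₂
    have hyT := harc.eq_zero_of_position_eq_zero hm hsT hyT0
    refine ⟨_, hy.ite_Ici hsT.le (isFilippovSolutionOn_zero hd hm (hs.trans hsT.le)) hyT, ?_⟩
    rw [if_pos hsT.le, ← hxy ⟨le_rfl, hsT⟩, hxs]
  · refine ⟨x, .of_exhaustion (t := τ) (fun u hu => ⟨hu, ?_⟩) fun n _ => (hx n).1, hxs⟩
    obtain ⟨_, ⟨n, rfl⟩, hn⟩ := not_bddAbove_iff.1 hbdd u
    exact ⟨n, hn.le⟩

theorem exists_solution_Ici (hd : IsAdmissibleDisturbance D d) (hm : 0 < γ - D) (hD : 0 ≤ D)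
    (hs : 0 ≤ s) (x₀ : Plane) :
    ∃ x, IsFilippovSolutionOn (closedLoop γ d) x (Ici s) ∧ x s = x₀ := by
  have right : ∀ (d : ℝ → ℝ) (x₀ : Plane), IsAdmissibleDisturbance D d →
      0 < x₀ 0 ∨ x₀ 0 = 0 ∧ 0 < x₀ 1 →
      ∃ x, IsFilippovSolutionOn (closedLoop γ d) x (Ici s) ∧ x s = x₀ := by
    rintro d x₀ hd (hp | ⟨hp, hq⟩)
    · exact exists_solution_of_pos hd hm hD hs hp
    · obtain ⟨s₁, x, hss₁, hx, hxs, hpos⟩ := exists_arc_of_axis hd hm hD hs hp hq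
      obtain ⟨y, hy, hys⟩ := exists_solution_of_pos hd hm hD (hs.trans hss₁.le) hpos
      exact ⟨_, hx.ite_Ici hss₁.le hy hys.symm, by rw [if_pos hss₁.le, hxs]⟩
  have left : 0 < (-x₀) 0 ∨ (-x₀) 0 = 0 ∧ 0 < (-x₀) 1 →
      ∃ x, IsFilippovSolutionOn (closedLoop γ d) x (Ici s) ∧ x s = x₀ := fun h => by
    obtain ⟨x, hx, hxs⟩ := right (fun t => -d t) (-x₀) hd.neg h
    exact ⟨_, hx.closedLoop_neg, by rw [hxs, neg_neg]⟩
  simp only [PiLp.neg_apply, Left.neg_pos_iff, neg_eq_zero] at left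
  rcases lt_trichotomy (x₀ 0) 0 with h₀ | h₀ | h₀
  · exact left (.inl h₀)
  · rcases lt_trichotomy (x₀ 1) 0 with h₁ | h₁ | h₁
    · exact left (.inr ⟨h₀, h₁⟩)
    · refine ⟨_, isFilippovSolutionOn_zero hd hm hs, ?_⟩
      ext i; fin_cases i <;> simp [h₀, h₁]
    · exact right d x₀ hd (.inr ⟨h₀, h₁⟩)
  · exact right d x₀ hd (.inl h₀)

/-- Forward completeness: a solution that meets the line `x 0 = 0` at a positive time stays at the
origin from then on, and any other solution has a limit at the right endpoint. -/
theorem IsFilippovSolutionOn.exists_extension_Ici (hd : IsAdmissibleDisturbance D d)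
    (hm : 0 < γ - D) (hD : 0 ≤ D) (ha : 0 ≤ a) (haT : a < T)
    (hx : IsFilippovSolutionOn (closedLoop γ d) x (Ico a T)) :
    ∃ y, IsFilippovSolutionOn (closedLoop γ d) y (Ici a) ∧ EqOn x y (Ico a T) := by
  by_cases hne : ∀ t ∈ Ioo a T, x t 0 ≠ 0
  · obtain ⟨y, hy, hxy⟩ := hx.exists_extension_Icc hd hm (by linarith) ha haT hne
    obtain ⟨z, hz, hzT⟩ := exists_solution_Ici hd hm hD (ha.trans haT.le) (y T)
    refine ⟨_, hy.ite_Ici haT.le hz hzT.symm, fun t ht => ?_⟩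
    simp only [ht.2.le, if_true]
    exact hxy ht
  · push Not at hne
    obtain ⟨s, hs, hs0⟩ := hne
    have harc : ∀ b c, a ≤ b → b ≤ c → c < T → IsInclusionArc γ D x b c := fun b c hab hbc hc =>
      hx.isInclusionArc hd measurableSet_Ico (ha.trans hab) hbc
        fun t ht => ⟨hab.trans ht.1, ht.2.trans_lt hc⟩
    have hxs := (harc a s le_rfl hs.1.le hs.2).eq_zero_of_position_eq_zero hm hs.1 hs0
    refine ⟨_, (hx.mono (Icc_subset_Ico_right hs.2)).ite_Ici hs.1.le
      (isFilippovSolutionOn_zero hd hm (ha.trans hs.1.le)) hxs, fun t ht => ?_⟩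
    by_cases h : t ≤ s
    · simp [h]
    · simp only [h, if_false]
      have h := (not_le.1 h).le
      exact (harc s t hs.1.le h ht.2).eq_zero_of_eq_zero hm h hxs

end GlobalExistence

/-! ### Uniform global asymptotic stability -/

theorem mainTheorem2 (γ D : ℝ) (hD : 0 < D)
    (hγ : 2 * Real.sqrt 2 * D ^ (3 / 2 : ℝ) + D + 1 / 2 < γ) :
    IsUniformlyGloballyAsymptoticallyStable
      {f : ℝ → EuclideanSpace ℝ (Fin 2) → EuclideanSpace ℝ (Fin 2) |
        ∃ d : ℝ → ℝ, IsAdmissibleDisturbance D d ∧ f = closedLoop γ d} := by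
  have hm : 0 < γ - D := by
    have : 0 ≤ 2 * Real.sqrt 2 * D ^ (3 / 2 : ℝ) := by positivity
    linarith
  have hM : 0 < γ + D := by linarith
  have harc : ∀ d : ℝ → ℝ, IsAdmissibleDisturbance D d → ∀ x : ℝ → Plane,
      IsFilippovSolutionOn (closedLoop γ d) x (Ici 0) → ∀ t : ℝ, 0 ≤ t →
      IsInclusionArc γ D x 0 t := fun d hd x hx t ht =>
    hx.isInclusionArc hd measurableSet_Ici le_rfl ht Icc_subset_Ici_self
  refine ⟨?_, ?_, ?_, ?_⟩
  · rintro _ ⟨d, hd, rfl⟩ x₀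
    exact exists_solution_Ici hd hm hD.le le_rfl x₀
  · rintro _ ⟨d, hd, rfl⟩ T hT x hx
    exact hx.exists_extension_Ici hd hm hD.le le_rfl hT
  · obtain ⟨α, hα, h⟩ := exists_stability_gain hm hM.le
    refine ⟨α, hα, ?_⟩
    rintro ε hε _ ⟨d, hd, rfl⟩ x hx hx0 t ht
    exact h ε hε x 0 t (harc d hd x hx t ht) ht hx0
  · intro r hr ε hε
    obtain ⟨T, hT, h⟩ := exists_attraction_time hm hM hr hε
    refine ⟨T, hT, ?_⟩
    rintro _ ⟨d, hd, rfl⟩ x hx hx0 t ht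
    exact h x 0 t (harc d hd x hx t (hT.le.trans ht)) hx0.le (by linarith)
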